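/- Let $P\subset\mathbb{R}^2$ be a (convex) heptagon, i.e. a $2$-dimensional convex polytope with exactly $7$ vertices. A section of a polytope $Q\subset\mathbb{R}^d$ is its intersection with an affine subspace, where $P$ is regarded as a subset of $\mathbb{R}^d$ through an injective affine map $\mathbb{R}^2\to\mathbb{R}^d$. The intersection complexity $\mathrm{ic}(P)$ is the minimal number of vertices of a polytope (of any dimension) that has $P$ as a section; the extension complexity $\mathrm{ec}(P)$ is the minimal number of facets of a polytope $Q\subset\mathbb{R}^d$ ($d$ arbitrary) such that $P$ is the image of $Q$ under a linear map $\mathbb{R}^d\to\mathbb{R}^2$. Then $$\mathrm{ic}(P)=6\qquad\text{and}\qquad \mathrm{ec}(P)=6 .$$ More precisely, $P$ is a section of a $3$-dimensional polytope in $\mathbb{R}^3$ with at most $6$ vertices, and $P$ is not a section of any polytope, of any dimension, with at most $5$ vertices. -/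

import Mathlib

/-- A convex polytope in `ℝ^d`: the convex hull of a finite set of points. -/
def IsPolytope {d : ℕ} (Q : Set (EuclideanSpace ℝ (Fin d))) : Prop :=
  ∃ s : Set (EuclideanSpace ℝ (Fin d)), s.Finite ∧ Q = convexHull ℝ s

/-- The dimension of (the affine hull of) a nonempty set. -/
noncomputable def polyDim {d : ℕ} (Q : Set (EuclideanSpace ℝ (Fin d))) : ℕ :=
  Module.finrank ℝ (vectorSpan ℝ Q)

/-- The vertices of a polytope are its extreme points. -/
def vertexSet {d : ℕ} (Q : Set (EuclideanSpace ℝ (Fin d))) :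
    Set (EuclideanSpace ℝ (Fin d)) :=
  Q.extremePoints ℝ

/-- The facets of a polytope: its nonempty faces (sets of maximizers in `Q` of a linear
functional) of dimension `dim Q - 1`. -/
def facetSet {d : ℕ} (Q : Set (EuclideanSpace ℝ (Fin d))) :
    Set (Set (EuclideanSpace ℝ (Fin d))) :=
  {F | F.Nonempty ∧ IsExposed ℝ Q F ∧ polyDim F + 1 = polyDim Q}

/-- A convex `n`-gon: a two-dimensional polytope in the plane with exactly `n` vertices. -/
def IsNGon (n : ℕ) (P : Set (EuclideanSpace ℝ (Fin 2))) : Prop :=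
  IsPolytope P ∧ polyDim P = 2 ∧ (vertexSet P).encard = n

/-- `P ⊆ ℝ^k` is a section of `Q ⊆ ℝ^d`: after embedding `ℝ^k` affinely into `ℝ^d`, the set `P`
becomes the intersection of `Q` with an affine subspace. -/
def IsSectionOf {k d : ℕ} (P : Set (EuclideanSpace ℝ (Fin k)))
    (Q : Set (EuclideanSpace ℝ (Fin d))) : Prop :=
  ∃ (f : EuclideanSpace ℝ (Fin k) →ᵃ[ℝ] EuclideanSpace ℝ (Fin d))
    (H : AffineSubspace ℝ (EuclideanSpace ℝ (Fin d))),
    Function.Injective f ∧ f '' P = Q ∩ (H : Set (EuclideanSpace ℝ (Fin d)))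

/-- `Q ⊆ ℝ^d` is an extension of `P ⊆ ℝ^k`: `P` is the image of the polytope `Q` under a
linear map. -/
def IsExtensionOf {k d : ℕ} (Q : Set (EuclideanSpace ℝ (Fin d)))
    (P : Set (EuclideanSpace ℝ (Fin k))) : Prop :=
  IsPolytope Q ∧
    ∃ π : EuclideanSpace ℝ (Fin d) →ₗ[ℝ] EuclideanSpace ℝ (Fin k), π '' Q = P

/-- The intersection complexity of `P`: the minimal number of vertices of a polytope (of any
dimension) that has `P` as a section. -/
noncomputable def intersectionComplexity {k : ℕ} (P : Set (EuclideanSpace ℝ (Fin k))) : ℕ :=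
  sInf {m : ℕ | ∃ (d : ℕ) (Q : Set (EuclideanSpace ℝ (Fin d))),
    IsPolytope Q ∧ IsSectionOf P Q ∧ (vertexSet Q).encard = m}

/-- The extension complexity of `P`: the minimal number of facets of an extension of `P`. -/
noncomputable def extensionComplexity {k : ℕ} (P : Set (EuclideanSpace ℝ (Fin k))) : ℕ :=
  sInf {m : ℕ | ∃ (d : ℕ) (Q : Set (EuclideanSpace ℝ (Fin d))),
    IsExtensionOf Q P ∧ (facetSet Q).encard = m}

/-!
Lower bound. Choose preimages `y i`, in an extension `Q`, of the vertices `p i` of a convex polygon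
in cyclic order, and let `B i` be the set of facets of `Q` containing `y i`. If
`B j ∩ B (j + 1) ⊆ B i`, then the segment from `y i` to the midpoint of `y j` and `y (j + 1)` can be
prolonged inside `Q`; as the edge `p j p (j + 1)` supports the polygon, this forces
`i ∈ {j, j + 1}`. A counting argument shows that no seven subsets of a set of size at most five
behave like this. A section of a polytope with `m` vertices has an extension with at most `m`
facets, whose points are the convex weights on those vertices that represent a point of the section,
so the bound holds for both complexities.

Upper bound. Points of the plane are rays in `ℝ × ℝ²`. If all sums `a + b` with `a ∈ A` and `b ∈ B`
have positive first coordinate, the convex hull of the points they represent is a section of a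
polytope with at most `|A| + |B|` vertices. Vectors `w i` over the vertices of a heptagon can be
scaled so that `w 2 = w 1 + w 3 - w 0` and `w 5 = w 4 + w 6 - w 0`. Then `A = {w 4, w 0, w 3}` and
`B = {w 6 - w 0, 0, w 1 - w 0}` have as sums all the `w i` and two further vectors,
`w 1 + w 4 - w 0` and `w 3 + w 6 - w 0`, which do no harm if two inequalities between areas of
triangles hold. Multiplying around the heptagon shows that each inequality holds for some base
vertex `p 0`. If the second fails at a base vertex, the first holds three vertices further on; so if
they never held together, the first would hold, and the second fail, at every base vertex.
-/

section SetFamilies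

open Finset

variable {ι T : Type*} [DecidableEq T]

theorem card_le_choose_of_incomparable {J : Finset ι} {B : ι → Finset T} {U : Finset T}
    (hB : ∀ i ∈ J, ∀ j ∈ J, B i ⊆ B j → i = j) (hU : ∀ i ∈ J, ∀ j ∈ J, B i \ U ⊆ B j) :
    #J ≤ (#U).choose (#U / 2) := by
  classical
  let trace (i : ι) : Finset U := (B i).subtype (· ∈ U)
  have htrace : ∀ i ∈ J, ∀ j ∈ J, trace i ⊆ trace j → i = j := fun i hi j hj h =>
    hB i hi j hj fun x hx => by
      by_cases hxU : x ∈ U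
      · simpa [trace] using @h ⟨x, hxU⟩ (by simpa [trace] using hx)
      · exact hU i hi j hj (mem_sdiff.2 ⟨hx, hxU⟩)
  have hanti : IsAntichain (· ⊆ ·) (J.image trace : Set (Finset U)) := by
    simp only [IsAntichain, Set.Pairwise, coe_image]
    rintro _ ⟨i, hi, rfl⟩ _ ⟨j, hj, rfl⟩ hne h
    exact hne (congrArg trace (htrace i hi j hj h))
  calc #J = #(J.image trace) :=
        (card_image_of_injOn fun i hi j hj h => htrace i hi j hj h.subset).symm
    _ ≤ (#U).choose (#U / 2) := by simpa using hanti.sperner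

theorem card_le_three_of_incomparable {J : Finset ι} {B : ι → Finset T} {U : Finset T} {a : T}
    (hB : ∀ i ∈ J, ∀ j ∈ J, B i ⊆ B j → i = j) (hU : ∀ i ∈ J, ∀ j ∈ J, B i \ U ⊆ B j)
    (hcard : #U ≤ 4) (ha : a ∈ U) (haB : ∀ i ∈ J, ∀ j ∈ J, a ∈ B i → a ∈ B j) : #J ≤ 3 := by
  have hle : #(U.erase a) ≤ 3 := by rw [card_erase_of_mem ha]; omega
  calc #J ≤ (#(U.erase a)).choose (#(U.erase a) / 2) := by
        refine card_le_choose_of_incomparable hB fun i hi j hj x hx => ?_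
        simp only [mem_sdiff, mem_erase, not_and'] at hx
        by_cases hxU : x ∈ U
        · obtain rfl := not_not.1 (hx.2 hxU)
          exact haB i hi j hj hx.1
        · exact hU i hi j hj (mem_sdiff.2 ⟨hx.1, hxU⟩)
    _ ≤ 3 := by interval_cases #(U.erase a) <;> decide

theorem card_inter_eq_two_of_incomparable {J : Finset ι} {B : ι → Finset T} {U : Finset T}
    (hB : ∀ i ∈ J, ∀ j ∈ J, B i ⊆ B j → i = j) (hU : ∀ i ∈ J, ∀ j ∈ J, B i \ U ⊆ B j)
    (hcard : #U ≤ 4) (hJ : 5 ≤ #J) {i : ι} (hi : i ∈ J) : #(B i ∩ U) = 2 := by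
  classical
  obtain ⟨j, hj, hji⟩ := exists_mem_ne (by omega : 1 < #J) i
  have contra {a : T} (ha : a ∈ U)
      (haB : ∀ k ∈ J.erase i, ∀ l ∈ J.erase i, a ∈ B k → a ∈ B l) : False := by
    have := card_le_three_of_incomparable (J := J.erase i)
      (fun k hk l hl => hB k (mem_of_mem_erase hk) l (mem_of_mem_erase hl))
      (fun k hk l hl => hU k (mem_of_mem_erase hk) l (mem_of_mem_erase hl)) hcard ha haB
    rw [card_erase_of_mem hi] at this
    omega
  have hsplit := card_inter_add_card_sdiff U (B i)
  rw [inter_comm] at hsplit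
  by_contra hne
  rcases (by omega : #(B i ∩ U) ≤ 1 ∨ #(U \ B i) ≤ 1) with h | h
  · obtain ⟨a, hai, haj⟩ := not_subset.1 fun h => hji (hB i hi j hj h).symm
    have haU : a ∈ U := by_contra fun haU => haj (hU i hi j hj (mem_sdiff.2 ⟨hai, haU⟩))
    refine contra haU fun k hk l _ hak => (ne_of_mem_erase hk ?_).elim
    refine (hB i hi k (mem_of_mem_erase hk) fun x hx => ?_).symm
    by_cases hxU : x ∈ U
    · rwa [card_le_one.1 h x (by simp [*]) a (by simp [*])]
    · exact hU i hi k (mem_of_mem_erase hk) (mem_sdiff.2 ⟨hx, hxU⟩)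
  · obtain ⟨a, haj, hai⟩ := not_subset.1 fun h => hji (hB j hj i hi h)
    have haU : a ∈ U := by_contra fun haU => hai (hU j hj i hi (mem_sdiff.2 ⟨haj, haU⟩))
    refine contra haU fun k _ l hl _ => by_contra fun hal => ne_of_mem_erase hl ?_
    refine hB l (mem_of_mem_erase hl) i hi fun x hx => by_contra fun hxi => hal ?_
    by_cases hxU : x ∈ U
    · rwa [card_le_one.1 h a (by simp [*]) x (by simp [*])]
    · exact (hxi (hU l (mem_of_mem_erase hl) i hi (mem_sdiff.2 ⟨hx, hxU⟩))).elim

theorem sum_card_inter_eq_sum_card_filter_mem (J : Finset ι) (U : Finset T) (B : ι → Finset T) :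
    ∑ i ∈ J, #(B i ∩ U) = ∑ t ∈ U, #{i ∈ J | t ∈ B i} := by
  simp only [inter_comm (B _) U, ← filter_mem_eq_inter]
  exact sum_card_bipartiteAbove_eq_sum_card_bipartiteBelow fun i t => t ∈ B i

theorem three_le_card_filter_add_one_mem {J : Finset (Fin 7)} (hJ : 5 ≤ #J) :
    3 ≤ #{j ∈ J | j + 1 ∈ J} := by
  have hinter : J ∩ J.map (addRightEmbedding (-1)) = ({j ∈ J | j + 1 ∈ J} : Finset _) := by
    ext j
    simp [← sub_eq_add_neg, sub_eq_iff_eq_add]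
  have hunion := card_le_univ (J ∪ J.map (addRightEmbedding (-1)))
  have := card_union_add_card_inter J (J.map (addRightEmbedding (-1)))
  rw [hinter, card_map] at this
  rw [Fintype.card_fin] at hunion
  omega

theorem card_compl_singleton_le_four [Fintype T] (hT : Fintype.card T ≤ 5) (t : T) :
    #({t}ᶜ : Finset T) ≤ 4 := by
  rw [card_compl, card_singleton]
  omega

theorem sdiff_compl_singleton_subset [Fintype T] {A C : Finset T} {t : T} (ht : t ∈ C) :
    A \ {t}ᶜ ⊆ C := by
  rw [sdiff_compl, inf_eq_inter]
  exact inter_subset_right.trans (singleton_subset_iff.2 ht)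

/-- The incidence pattern between the vertices of an `n`-gon and sets which contain an edge as soon
as they contain its midpoint: the intersection of two cyclically consecutive sets is contained in
no further set of the family. -/
def IsPolygonalFamily {n : ℕ} [NeZero n] (B : Fin n → Finset T) : Prop :=
  ∀ i j, B j ∩ B (j + 1) ⊆ B i → i = j ∨ i = j + 1

namespace IsPolygonalFamily

theorem eq_of_subset {n : ℕ} [NeZero n] {B : Fin n → Finset T} (hB : IsPolygonalFamily B)
    (h2 : (1 + 1 : Fin n) ≠ 0) {i j : Fin n} (h : B i ⊆ B j) : i = j := by
  rcases hB j i (inter_subset_left.trans h) with h' | h'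
  · exact h'.symm
  rcases hB j (i - 1) (by simpa using inter_subset_right.trans h) with h'' | h''
  · rw [h', eq_sub_iff_add_eq, add_assoc, add_eq_left] at h''
    exact absurd h'' h2
  · simpa using h''.symm

theorem compl_inter [Fintype T] {n : ℕ} [NeZero n] {B : Fin n → Finset T}
    (hB : IsPolygonalFamily B) : IsPolygonalFamily fun j => (B j ∩ B (j + 1))ᶜ := by
  intro i j h
  rw [← compl_union, compl_subset_compl] at h
  have := hB (j + 1) i (h.trans (union_subset inter_subset_right inter_subset_left))
  rwa [add_left_inj, eq_comm, or_comm, eq_comm] at this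

variable [Fintype T] {B : Fin 7 → Finset T}

theorem card_inter_compl_singleton_eq_two (hB : IsPolygonalFamily B) (hT : Fintype.card T ≤ 5)
    {t : T} (ht : 5 ≤ #{j | t ∈ B j}) {i : Fin 7} (hi : t ∈ B i) : #(B i ∩ {t}ᶜ) = 2 :=
  card_inter_eq_two_of_incomparable (fun _ _ _ _ => hB.eq_of_subset (by decide))
    (fun _ _ j hj => sdiff_compl_singleton_subset ((mem_filter_univ j).1 hj))
    (card_compl_singleton_le_four hT t) ht ((mem_filter_univ i).2 hi)

theorem exists_filter_mem_eq_pair (hB : IsPolygonalFamily B) (hT : Fintype.card T ≤ 5) {t : T}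
    (ht : 5 ≤ #{j | t ∈ B j}) {j : Fin 7} (hj : t ∈ B j) (hj' : t ∈ B (j + 1)) :
    ∃ s ≠ t, ({i | t ∈ B i ∧ s ∈ B i} : Finset (Fin 7)) = {j, j + 1} := by
  obtain ⟨s, hs, hst⟩ : ∃ s ∈ B j ∩ B (j + 1), s ≠ t := by
    by_contra! h
    have hsub : ({i | t ∈ B i} : Finset (Fin 7)) ⊆ {j, j + 1} := fun i hi => by
      simpa using hB i j fun s hs => h s hs ▸ (mem_filter_univ i).1 hi
    have := (card_le_card hsub).trans card_le_two
    omega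
  rw [mem_inter] at hs
  have hcard {i : Fin 7} (hi : t ∈ B i) : #(B i ∩ {t}ᶜ) = 2 :=
    hB.card_inter_compl_singleton_eq_two hT ht hi
  have hinter : B j ∩ B (j + 1) ⊆ {t, s} := by
    intro x hx
    rw [mem_inter] at hx
    by_contra hx'
    simp only [mem_insert, mem_singleton, not_or] at hx'
    have hpair {i : Fin 7} (hi : t ∈ B i) (hsi : s ∈ B i) (hxi : x ∈ B i) :
        B i ∩ {t}ᶜ = {s, x} :=
      (eq_of_subset_of_card_le (by simp [insert_subset_iff, *])
        (by rw [hcard hi, card_pair (Ne.symm hx'.2)])).symm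
    have : B j = B (j + 1) := by
      rw [← insert_erase hj, ← insert_erase hj', erase_eq, erase_eq, sdiff_eq_inter_compl,
        sdiff_eq_inter_compl, hpair hj hs.1 hx.1, hpair hj' hs.2 hx.2]
    simpa using hB.eq_of_subset (by decide) this.subset
  refine ⟨s, hst, ?_⟩
  ext i
  simp only [mem_filter_univ, mem_insert, mem_singleton]
  refine ⟨fun ⟨hti, hsi⟩ => hB i j (hinter.trans ?_), ?_⟩
  · simp [insert_subset_iff, hti, hsi]
  · rintro (rfl | rfl)
    exacts [⟨hj, hs.1⟩, ⟨hj', hs.2⟩]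

theorem three_le_card_filter_card_le_two (hB : IsPolygonalFamily B) (hT : Fintype.card T ≤ 5)
    {t : T} (ht : 5 ≤ #{j | t ∈ B j}) :
    3 ≤ #{s ∈ {t}ᶜ | #{i | t ∈ B i ∧ s ∈ B i} ≤ 2} := by
  have hpairs (j : Fin 7) : ∃ s, t ∈ B j ∧ t ∈ B (j + 1) →
      s ≠ t ∧ ({i | t ∈ B i ∧ s ∈ B i} : Finset (Fin 7)) = {j, j + 1} := by
    by_cases hj : t ∈ B j ∧ t ∈ B (j + 1)
    · obtain ⟨s, hs⟩ := hB.exists_filter_mem_eq_pair hT ht hj.1 hj.2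
      exact ⟨s, fun _ => hs⟩
    · exact ⟨t, fun h => absurd h hj⟩
  choose s hs using hpairs
  refine (three_le_card_filter_add_one_mem ht).trans (card_le_card_of_injOn s ?_ ?_)
  · intro j hj
    simp only [coe_filter, mem_filter_univ] at hj
    obtain ⟨hst, hpair⟩ := hs j hj
    simp [hst, hpair]
  · intro i hi j hj hij
    simp only [coe_filter, mem_filter_univ] at hi hj
    have hpair : ({i, i + 1} : Finset (Fin 7)) = {j, j + 1} := by
      rw [← (hs i hi).2, ← (hs j hj).2, hij]
    clear * - hpair
    decide +revert

theorem card_filter_mem_and_mem_le_three (hB : IsPolygonalFamily B) (hT : Fintype.card T ≤ 5)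
    {s t : T} (hst : s ≠ t) : #{i | t ∈ B i ∧ s ∈ B i} ≤ 3 := by
  refine card_le_three_of_incomparable (B := B) (U := {t}ᶜ) (a := s)
    (fun _ _ _ _ => hB.eq_of_subset (by decide)) (fun i _ j hj => ?_)
    (card_compl_singleton_le_four hT t) (by simpa) (fun i _ j hj _ => ?_) <;>
  rw [mem_filter_univ] at hj
  exacts [sdiff_compl_singleton_subset hj.1, hj.2]

theorem card_filter_mem_le_four (hB : IsPolygonalFamily B) (hT : Fintype.card T ≤ 5) (t : T) :
    #{j | t ∈ B j} ≤ 4 := by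
  by_contra! ht
  have hle (s : T) (hs : s ∈ ({t}ᶜ : Finset T)) :
      #{i | t ∈ B i ∧ s ∈ B i} + (if #{i | t ∈ B i ∧ s ∈ B i} ≤ 2 then 1 else 0) ≤ 3 := by
    split_ifs with h
    exacts [Nat.succ_le_succ h, hB.card_filter_mem_and_mem_le_three hT (by simpa using hs)]
  have hsum : ∑ s ∈ {t}ᶜ, #{i | t ∈ B i ∧ s ∈ B i} = #{j | t ∈ B j} * 2 := by
    simp only [← filter_filter, ← sum_card_inter_eq_sum_card_filter_mem]
    exact sum_const_nat fun i hi =>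
      hB.card_inter_compl_singleton_eq_two hT ht ((mem_filter_univ i).1 hi)
  have hsum' := sum_le_sum hle
  rw [sum_add_distrib, hsum, sum_const, smul_eq_mul, ← sum_filter, ← card_eq_sum_ones] at hsum'
  have := hB.three_le_card_filter_card_le_two hT ht
  have := card_compl_singleton_le_four hT t
  omega

theorem six_le_card (hB : IsPolygonalFamily B) : 6 ≤ Fintype.card T := by
  by_contra! hT
  have hinter (j : Fin 7) : #(B j ∩ B (j + 1)) + 1 ≤ #(B j) :=
    card_lt_card <| inter_subset_left.ssubset_of_ne fun h => by
      simpa using hB.eq_of_subset (by decide) (inter_eq_left.1 h)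
  have hsum : ∑ j, (#(B j) + #(B j ∩ B (j + 1))ᶜ) ≤ 8 * Fintype.card T :=
    calc ∑ j, (#(B j) + #(B j ∩ B (j + 1))ᶜ)
        = ∑ t, (#{j | t ∈ B j} + #{j | t ∈ (B j ∩ B (j + 1))ᶜ}) := by
          simpa only [sum_add_distrib, inter_univ] using congrArg₂ (· + ·)
            (sum_card_inter_eq_sum_card_filter_mem univ univ B)
            (sum_card_inter_eq_sum_card_filter_mem univ univ fun j => (B j ∩ B (j + 1))ᶜ)
      _ ≤ ∑ _t : T, (4 + 4) := sum_le_sum fun t _ => add_le_add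
          (hB.card_filter_mem_le_four (by omega) t)
          (hB.compl_inter.card_filter_mem_le_four (by omega) t)
      _ = 8 * Fintype.card T := by simp [mul_comm]
  have hsum' : 7 * (Fintype.card T + 1) ≤ ∑ j, (#(B j) + #(B j ∩ B (j + 1))ᶜ) := by
    simpa using card_nsmul_le_sum univ (fun j => #(B j) + #(B j ∩ B (j + 1))ᶜ)
      (Fintype.card T + 1) fun j _ => by
        have := hinter j
        have := card_add_card_compl (B j ∩ B (j + 1))
        omega
  omega

end IsPolygonalFamily

end SetFamilies

theorem encard_range_le {α : Type*} {n : ℕ} (f : Fin n → α) : (Set.range f).encard ≤ n := by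
  simpa [← Set.image_univ] using Set.encard_image_le f Set.univ

section Polytopes

variable {d : ℕ} {Q : Set (EuclideanSpace ℝ (Fin d))}

theorem IsPolytope.convex (hQ : IsPolytope Q) : Convex ℝ Q := by
  obtain ⟨s, -, rfl⟩ := hQ
  exact convex_convexHull ℝ s

theorem IsPolytope.finite_vertexSet (hQ : IsPolytope Q) : (vertexSet Q).Finite := by
  obtain ⟨s, hs, rfl⟩ := hQ
  exact hs.subset extremePoints_convexHull_subset

theorem eq_convexHull_vertexSet_of_isCompact (hQ : IsCompact Q) (hc : Convex ℝ Q)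
    (hf : (vertexSet Q).Finite) : Q = convexHull ℝ (vertexSet Q) := by
  conv_lhs => rw [← closure_convexHull_extremePoints hQ hc]
  exact (hf.isClosed_convexHull (𝕜 := ℝ)).closure_eq

theorem IsPolytope.eq_convexHull_vertexSet (hQ : IsPolytope Q) :
    Q = convexHull ℝ (vertexSet Q) := by
  refine eq_convexHull_vertexSet_of_isCompact ?_ hQ.convex hQ.finite_vertexSet
  obtain ⟨s, hs, rfl⟩ := hQ
  exact hs.isCompact_convexHull (𝕜 := ℝ)

theorem encard_vertexSet_convexHull_le {s : Set (EuclideanSpace ℝ (Fin d))} :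
    (vertexSet (convexHull ℝ s)).encard ≤ s.encard :=
  Set.encard_le_encard extremePoints_convexHull_subset

end Polytopes

theorem exists_nonneg_sum_insert_smul_eq {𝕜 M ι : Type*} [DecidableEq ι] [Semiring 𝕜]
    [PartialOrder 𝕜] [AddCommMonoid M] [Module 𝕜 M] {s : Finset ι} {j : ι} {c : ι → 𝕜} {r : 𝕜}
    (a : ι → M) (hj : j ∉ s) (hc : ∀ i, 0 ≤ c i) (hr : 0 ≤ r) :
    ∃ c' : ι → 𝕜, (∀ i, 0 ≤ c' i) ∧
      r • a j + ∑ i ∈ s, c i • a i = ∑ i ∈ insert j s, c' i • a i := by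
  refine ⟨Function.update c j r, fun i => ?_, ?_⟩
  · rcases eq_or_ne i j with rfl | hij <;> simp [*]
  · rw [Finset.sum_insert hj, Function.update_self]
    refine congrArg _ (Finset.sum_congr rfl fun i hi => ?_)
    rw [Function.update_of_ne (ne_of_mem_of_not_mem hi hj)]

theorem exists_nonneg_sum_smul_eq {𝕜 V ι : Type*} [Field 𝕜] [LinearOrder 𝕜] [IsStrictOrderedRing 𝕜]
    [AddCommGroup V] [Module 𝕜 V] (s : Finset ι) (a : ι → V →ₗ[𝕜] 𝕜) (b : V →ₗ[𝕜] 𝕜)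
    (h : ∀ x, (∀ i ∈ s, a i x ≤ 0) → b x ≤ 0) :
    ∃ c : ι → 𝕜, (∀ i, 0 ≤ c i) ∧ b = ∑ i ∈ s, c i • a i := by
  classical
  induction s using Finset.induction_on generalizing a b with
  | empty =>
    refine ⟨0, fun _ => le_rfl, LinearMap.ext fun x => le_antisymm ?_ ?_⟩
    · simpa using h x
    · simpa using h (-x)
  | insert j s hj ih =>
    by_cases hs : ∀ x, (∀ i ∈ s, a i x ≤ 0) → b x ≤ 0
    · obtain ⟨c, hc, hb⟩ := ih a b hs
      obtain ⟨c', hc', hsum⟩ := exists_nonneg_sum_insert_smul_eq a hj hc le_rfl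
      exact ⟨c', hc', by rw [← hsum, zero_smul, zero_add, hb]⟩
    obtain ⟨z, hz, hbz, hjz⟩ : ∃ z, (∀ i ∈ s, a i z ≤ 0) ∧ 0 < b z ∧ a j z = 1 := by
      push Not at hs
      obtain ⟨z, hz, hbz⟩ := hs
      have hjz : 0 < a j z := by
        by_contra! hle
        exact hbz.not_ge (h z fun i hi => (Finset.mem_insert.1 hi).elim (· ▸ hle) (hz i))
      refine ⟨(a j z)⁻¹ • z, fun i hi => ?_, ?_, ?_⟩ <;> simp only [map_smul, smul_eq_mul]
      · exact mul_nonpos_of_nonneg_of_nonpos (by positivity) (hz i hi)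
      · positivity
      · exact inv_mul_cancel₀ hjz.ne'
    -- Projecting along `z` to the kernel of `a j` reduces to the functionals in `s`.
    obtain ⟨c, hc, hb⟩ := ih (fun i => a i - a i z • a j) (b - b z • a j) fun x hx => by
      have := h (x - a j x • z) fun i hi => by
        rcases Finset.mem_insert.1 hi with rfl | hi
        · simp [hjz]
        · simpa [mul_comm] using hx i hi
      simpa [mul_comm] using this
    have hr : 0 ≤ b z - ∑ i ∈ s, c i * a i z := sub_nonneg.2 <| hbz.le.trans' <|
      Finset.sum_nonpos fun i hi => mul_nonpos_of_nonneg_of_nonpos (hc i) (hz i hi)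
    obtain ⟨c', hc', hsum⟩ := exists_nonneg_sum_insert_smul_eq a hj hc hr
    refine ⟨c', hc', ?_⟩
    conv_lhs => rw [eq_add_of_sub_eq hb]
    rw [← hsum]
    simp only [smul_sub, smul_smul, Finset.sum_sub_distrib, ← Finset.sum_smul]
    module

theorem exists_nonneg_forall_add_mul_nonpos {ι 𝕜 : Type*} [Finite ι] [Field 𝕜] [LinearOrder 𝕜]
    [IsStrictOrderedRing 𝕜] {a b : ι → 𝕜} (ha : ∀ i, a i ≤ 0) (hb : ∃ i, 0 < b i) :
    ∃ t, 0 ≤ t ∧ (∀ i, a i + t * b i ≤ 0) ∧ ∃ i, 0 < b i ∧ a i + t * b i = 0 := by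
  obtain ⟨⟨i, hi⟩, hmin⟩ :=
    @Finite.exists_min {i // 0 < b i} 𝕜 _ (nonempty_subtype.2 hb) _ fun i => -a i / b i
  refine ⟨-a i / b i, div_nonneg (neg_nonneg.2 (ha i)) hi.le, fun j => ?_, i, hi, ?_⟩
  · rcases lt_or_ge 0 (b j) with hj | hj
    · have := (le_div_iff₀ hj).1 (hmin ⟨j, hj⟩)
      linarith
    · have := mul_nonpos_of_nonneg_of_nonpos (div_nonneg (neg_nonneg.2 (ha i)) hi.le) hj
      linarith [ha j]
  · field_simp
    ring

theorem exists_le_ker_and_pos {𝕜 V : Type*} [Field 𝕜] [LinearOrder 𝕜] [IsStrictOrderedRing 𝕜]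
    [AddCommGroup V] [Module 𝕜 V] {G : Submodule 𝕜 V} {v : V} (hv : v ∉ G) :
    ∃ m : V →ₗ[𝕜] 𝕜, G ≤ LinearMap.ker m ∧ 0 < m v := by
  obtain ⟨m, hm, hG⟩ := Submodule.exists_le_ker_of_notMem hv
  rcases hm.lt_or_gt with hm | hm
  · exact ⟨-m, fun z hz => by simpa using hG hz, by simpa using hm⟩
  · exact ⟨m, hG, hm⟩

section ExposedFaces

variable {d : ℕ} {Q F G : Set (EuclideanSpace ℝ (Fin d))} {x y : EuclideanSpace ℝ (Fin d)}

theorem isExposed_setOf_eq {l : EuclideanSpace ℝ (Fin d) →ₗ[ℝ] ℝ} (hx : x ∈ Q)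
    (hl : ∀ z ∈ Q, l z ≤ l x) : IsExposed ℝ Q {z ∈ Q | l z = l x} :=
  fun _ => ⟨LinearMap.toContinuousLinearMap l, Set.ext fun z => and_congr_right fun hz =>
    ⟨fun h w hw => h ▸ hl w hw, fun h => (hl z hz).antisymm (h x hx)⟩⟩

theorem exists_eq_setOf_of_isExposed (hF : IsExposed ℝ Q F) (hx : x ∈ F) :
    ∃ l : EuclideanSpace ℝ (Fin d) →ₗ[ℝ] ℝ,
      (∀ z ∈ Q, l z ≤ l x) ∧ F = {z ∈ Q | l z = l x} := by
  obtain ⟨l, rfl⟩ := hF ⟨x, hx⟩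
  exact ⟨l.toLinearMap, hx.2, Set.ext fun z => and_congr_right fun hz =>
    ⟨fun h => (hx.2 z hz).antisymm (h x hx.1), fun h w hw => (hx.2 w hw).trans h.ge⟩⟩

theorem mem_of_sub_mem_vectorSpan_of_isExposed (hF : IsExposed ℝ Q F) (hx : x ∈ F) (hy : y ∈ Q)
    (h : y - x ∈ vectorSpan ℝ F) : y ∈ F := by
  obtain ⟨l, -, rfl⟩ := exists_eq_setOf_of_isExposed hF hx
  have hle : vectorSpan ℝ {z ∈ Q | l z = l x} ≤ LinearMap.ker l := by
    rw [vectorSpan_eq_span_vsub_set_right ℝ hx, Submodule.span_le]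
    rintro _ ⟨z, hz, rfl⟩
    simp [hz.2]
  exact ⟨hy, by simpa [sub_eq_zero] using hle h⟩

theorem eq_of_polyDim_le_of_isExposed (hF : IsExposed ℝ Q F) (hne : F.Nonempty) (hFG : F ⊆ G)
    (hGQ : G ⊆ Q) (hdim : polyDim G ≤ polyDim F) : F = G := by
  obtain ⟨x, hx⟩ := hne
  have hspan := Submodule.eq_of_le_of_finrank_le (vectorSpan_mono ℝ hFG) hdim
  exact hFG.antisymm fun y hy => mem_of_sub_mem_vectorSpan_of_isExposed hF hx (hGQ hy)
    (hspan ▸ vsub_mem_vectorSpan ℝ hy (hFG hx))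

theorem exists_sub_notMem_of_lt_finrank {s : Set (EuclideanSpace ℝ (Fin d))}
    {G : Submodule ℝ (EuclideanSpace ℝ (Fin d))}
    (hG : Module.finrank ℝ G < polyDim (convexHull ℝ s)) (hx : x ∈ convexHull ℝ s) :
    ∃ v ∈ s, v - x ∉ G := by
  by_contra! h
  have hsub : convexHull ℝ s ⊆ AffineSubspace.mk' x G :=
    convexHull_min (fun v hv => (AffineSubspace.mem_mk').2 (h v hv)) (AffineSubspace.convex _)
  have hle : vectorSpan ℝ (convexHull ℝ s) ≤ G := by
    rw [vectorSpan_eq_span_vsub_set_right ℝ hx, Submodule.span_le]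
    rintro _ ⟨z, hz, rfl⟩
    exact (AffineSubspace.mem_mk').1 (hsub hz)
  exact (Submodule.finrank_mono hle).not_gt hG

-- Tilting a supporting hyperplane around the face and `y` until it meets another vertex.
theorem IsPolytope.exists_isExposed_vectorSpan_lt (hQ : IsPolytope Q) (hF : IsExposed ℝ Q F)
    (hx : x ∈ F) (hy : y ∈ Q) (hyF : y ∉ F) (hdim : polyDim F + 1 ≠ polyDim Q) :
    ∃ G, IsExposed ℝ Q G ∧ F ⊆ G ∧ y ∉ G ∧ vectorSpan ℝ F < vectorSpan ℝ G := by
  obtain ⟨l, hl, hFl⟩ := exists_eq_setOf_of_isExposed hF hx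
  have hFQ : F ⊆ Q := hF.subset
  obtain ⟨s, hs, rfl⟩ := hQ
  let H := vectorSpan ℝ F ⊔ Submodule.span ℝ {y - x}
  have hH : Module.finrank ℝ H < polyDim (convexHull ℝ s) := by
    have hlt : polyDim F < polyDim (convexHull ℝ s) := by
      by_contra! hle
      exact hyF (eq_of_polyDim_le_of_isExposed hF ⟨x, hx⟩ hFQ (Set.Subset.refl _) hle ▸ hy)
    have : Module.finrank ℝ H ≤ polyDim F + 1 :=
      (Submodule.finrank_add_le_finrank_add_finrank _ _).trans
        (Nat.add_le_add_left ((finrank_span_le_card _).trans (by simp)) _)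
    omega
  obtain ⟨v, hv, hvH⟩ := exists_sub_notMem_of_lt_finrank hH (hFQ hx)
  obtain ⟨m, hHm, hmv⟩ := exists_le_ker_and_pos hvH
  have hm {z : EuclideanSpace ℝ (Fin d)} (hz : z - x ∈ H) : m z = m x := by
    simpa [sub_eq_zero] using hHm hz
  have := hs.to_subtype
  obtain ⟨t, -, hle, ⟨w, hw⟩, hmw, heq⟩ := exists_nonneg_forall_add_mul_nonpos (ι := s)
    (a := fun z => l (z - x)) (b := fun z => m (z - x))
    (fun z => by simpa using hl z (subset_convexHull ℝ s z.2)) ⟨⟨v, hv⟩, hmv⟩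
  have hmax : ∀ z ∈ convexHull ℝ s, (l + t • m) z ≤ (l + t • m) x := by
    refine convexHull_min (fun z hz => ?_) (convex_halfSpace_le (l + t • m).isLinear _)
    have := hle ⟨z, hz⟩
    simp only [map_sub] at this
    change l z + t * m z ≤ l x + t * m x
    linarith
  have hFG : F ⊆ {z ∈ convexHull ℝ s | (l + t • m) z = (l + t • m) x} := fun z hz => by
    have hzH : z - x ∈ H := Submodule.mem_sup_left (vsub_mem_vectorSpan ℝ hz hx)
    rw [hFl] at hz
    exact ⟨hz.1, by simp [hz.2, hm hzH]⟩
  refine ⟨_, isExposed_setOf_eq (hFQ hx) hmax, hFG, fun hyG => hyF ?_,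
    (vectorSpan_mono ℝ hFG).lt_of_ne fun hspan => ?_⟩
  · have hyH : y - x ∈ H := Submodule.mem_sup_right (Submodule.mem_span_singleton_self _)
    exact hFl ▸ ⟨hy, by simpa [hm hyH] using hyG.2⟩
  · have hwF : w - x ∈ vectorSpan ℝ F := by
      rw [hspan]
      refine vsub_mem_vectorSpan ℝ ⟨subset_convexHull ℝ s hw, ?_⟩ (hFG hx)
      simp only [map_sub] at heq
      change l w + t * m w = l x + t * m x
      linarith
    exact hmw.ne' (hHm (Submodule.mem_sup_left hwF))

theorem exists_lineMap_mem_of_sub_eq_sum {ι : Type*} {s : Finset ι}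
    {g : ι → EuclideanSpace ℝ (Fin d)} {c : ι → ℝ} (hQ : Convex ℝ Q) (hx : x ∈ Q)
    (hg : ∀ i ∈ s, g i ∈ Q) (hc : ∀ i ∈ s, 0 ≤ c i) (hxy : x - y = ∑ i ∈ s, c i • (g i - x)) :
    ∃ ε : ℝ, 0 < ε ∧ AffineMap.lineMap y x (1 + ε) ∈ Q := by
  have hC : 0 ≤ ∑ i ∈ s, c i := Finset.sum_nonneg hc
  obtain ⟨z, hz, hxyz⟩ : ∃ z ∈ Q, x - y = (∑ i ∈ s, c i) • (z - x) := by
    rcases hC.eq_or_lt with h0 | h0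
    · have hc0 := (Finset.sum_eq_zero_iff_of_nonneg hc).1 h0.symm
      refine ⟨x, hx, ?_⟩
      rw [hxy, sub_self, smul_zero]
      exact Finset.sum_eq_zero fun i hi => by rw [hc0 i hi, zero_smul]
    · refine ⟨s.centerMass c g, hQ.centerMass_mem hc h0 hg, ?_⟩
      rw [hxy, Finset.centerMass, smul_sub, smul_inv_smul₀ h0.ne', Finset.sum_smul]
      simp only [smul_sub, Finset.sum_sub_distrib]
  have hε : 0 < (1 + ∑ i ∈ s, c i)⁻¹ := by positivity
  refine ⟨_, hε, ?_⟩
  have hmem := hQ.add_smul_sub_mem hx hz (t := (1 + ∑ i ∈ s, c i)⁻¹ * ∑ i ∈ s, c i)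
    ⟨by positivity, (inv_mul_le_one₀ (by positivity)).2 (by linarith)⟩
  rw [mul_smul, ← hxyz] at hmem
  convert hmem using 1
  rw [AffineMap.lineMap_apply_module]
  module

theorem IsPolytope.exists_isExposed_mem_notMem (hQ : IsPolytope Q) (hx : x ∈ Q) (hy : y ∈ Q)
    (h : ∀ ε : ℝ, 0 < ε → AffineMap.lineMap y x (1 + ε) ∉ Q) :
    ∃ F, IsExposed ℝ Q F ∧ x ∈ F ∧ y ∉ F := by
  obtain ⟨s, hs, rfl⟩ := hQ
  lift s to Finset (EuclideanSpace ℝ (Fin d)) using hs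
  by_contra! hexp
  have hle (w : EuclideanSpace ℝ (Fin d)) (hw : ∀ v ∈ s, innerₗ _ (v - x) w ≤ 0) :
      innerₗ _ (x - y) w ≤ 0 := by
    have hmax : ∀ z ∈ convexHull ℝ (s : Set (EuclideanSpace ℝ (Fin d))),
        innerₗ _ w z ≤ innerₗ _ w x := by
      refine convexHull_min (fun v hv => ?_) (convex_halfSpace_le (innerₗ _ w).isLinear _)
      change innerₗ _ w v ≤ innerₗ _ w x
      simpa [real_inner_comm w] using hw v hv
    have := (hexp _ (isExposed_setOf_eq hx hmax) ⟨hx, rfl⟩).2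
    simp [real_inner_comm w] at this ⊢
    linarith
  obtain ⟨c, hc, hsum⟩ := exists_nonneg_sum_smul_eq s _ _ hle
  have hxy : x - y = ∑ v ∈ s, c v • (v - x) := by
    refine ext_inner_right ℝ fun w => ?_
    simpa [sum_inner, real_inner_smul_left, inner_sub_left] using LinearMap.congr_fun hsum w
  obtain ⟨ε, hε, hmem⟩ := exists_lineMap_mem_of_sub_eq_sum (convex_convexHull ℝ _) hx
    (fun v hv => subset_convexHull ℝ _ hv) (fun v _ => hc v) hxy
  exact h ε hε hmem

theorem IsPolytope.exists_lineMap_mem (hQ : IsPolytope Q) (hx : x ∈ Q) (hy : y ∈ Q)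
    (hF : ∀ F ∈ facetSet Q, x ∈ F → y ∈ F) :
    ∃ ε : ℝ, 0 < ε ∧ AffineMap.lineMap y x (1 + ε) ∈ Q := by
  by_contra! h
  obtain ⟨F, ⟨hexp, hxF, hyF⟩, hmax⟩ := exists_maximalFor_of_wellFoundedGT _ (vectorSpan ℝ)
    (hQ.exists_isExposed_mem_notMem hx hy h)
  by_cases hdim : polyDim F + 1 = polyDim Q
  · exact hyF (hF F ⟨⟨x, hxF⟩, hexp, hdim⟩ hxF)
  · obtain ⟨G, hG, hFG, hyG, hlt⟩ :=
      hQ.exists_isExposed_vectorSpan_lt hexp hxF hy hyF hdim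
    exact hlt.not_ge (hmax ⟨hG, hFG hxF, hyG⟩ hlt.le)

end ExposedFaces

theorem exists_pos_forall_nonneg_add_mul {ι 𝕜 : Type*} [Finite ι] [Field 𝕜] [LinearOrder 𝕜]
    [IsStrictOrderedRing 𝕜] {a b : ι → 𝕜} (ha : ∀ i, 0 ≤ a i) (hab : ∀ i, a i = 0 → b i = 0) :
    ∃ ε, 0 < ε ∧ ∀ i, 0 ≤ a i + ε * b i := by
  by_cases hb : ∃ i, 0 < -b i
  · obtain ⟨t, ht, hle, i, hi, heq⟩ :=
      exists_nonneg_forall_add_mul_nonpos (a := -a) (b := -b) (fun i => neg_nonpos.2 (ha i)) hb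
    simp only [Pi.neg_apply] at hle heq hi
    refine ⟨t, ht.lt_of_ne fun h0 => hi.ne' ?_, fun i => by linarith [hle i]⟩
    rw [hab i (by simpa [← h0] using heq), neg_zero]
  · push Not at hb
    exact ⟨1, one_pos, fun i => by linarith [ha i, hb i]⟩

theorem mem_openSegment_lineMap {𝕜 E : Type*} [Field 𝕜] [LinearOrder 𝕜] [IsStrictOrderedRing 𝕜]
    [AddCommGroup E] [Module 𝕜 E] (x y : E) {ε : 𝕜} (hε : 0 < ε) :
    x ∈ openSegment 𝕜 y (AffineMap.lineMap y x (1 + ε)) := by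
  have h := lineMap_mem_openSegment 𝕜 y (AffineMap.lineMap y x (1 + ε)) (t := (1 + ε)⁻¹)
    ⟨by positivity, inv_lt_one_of_one_lt₀ (by linarith)⟩
  rwa [AffineMap.lineMap_lineMap_right, inv_mul_cancel₀ (by positivity),
    AffineMap.lineMap_apply_one] at h

section NonnegPart

variable {m : ℕ} {L : AffineSubspace ℝ (EuclideanSpace ℝ (Fin m))}
  {x y : EuclideanSpace ℝ (Fin m)} {F : Set (EuclideanSpace ℝ (Fin m))}

/-- The intersection of an affine subspace with the nonnegative orthant: a polyhedron in standard
form, with one inequality for each coordinate. -/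
def nonnegPart (L : AffineSubspace ℝ (EuclideanSpace ℝ (Fin m))) :
    Set (EuclideanSpace ℝ (Fin m)) :=
  {w | w ∈ L ∧ ∀ k, 0 ≤ w k}

theorem convex_nonnegPart : Convex ℝ (nonnegPart L) := by
  intro x hx y hy s t hs ht hst
  refine ⟨L.convex hx.1 hy.1 hs ht hst, fun k => ?_⟩
  have hxk := hx.2 k
  have hyk := hy.2 k
  simp only [PiLp.add_apply, PiLp.smul_apply, smul_eq_mul]
  positivity

theorem isClosed_nonnegPart : IsClosed (nonnegPart L) := by
  have h : nonnegPart L = (L : Set _) ∩ ⋂ k, {w | 0 ≤ w k} := by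
    ext w
    simp [nonnegPart]
  rw [h]
  exact L.closed_of_finiteDimensional.inter
    (isClosed_iInter fun k => isClosed_le continuous_const (by fun_prop))

theorem exists_lineMap_mem_nonnegPart (hx : x ∈ nonnegPart L) (hy : y ∈ nonnegPart L)
    (h : ∀ k, x k = 0 → y k = 0) :
    ∃ ε : ℝ, 0 < ε ∧ AffineMap.lineMap y x (1 + ε) ∈ nonnegPart L := by
  obtain ⟨ε, hε, hnn⟩ := exists_pos_forall_nonneg_add_mul (b := fun k => x k - y k) hx.2
    fun k hk => by rw [hk, h k hk, sub_zero]
  refine ⟨ε, hε, AffineMap.lineMap_mem _ hy.1 hx.1, fun k => ?_⟩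
  have := hnn k
  simp only [AffineMap.lineMap_apply_module, PiLp.add_apply, PiLp.smul_apply, smul_eq_mul]
  linarith

theorem finite_vertexSet_nonnegPart : (vertexSet (nonnegPart L)).Finite := by
  refine Set.Finite.of_injOn (f := fun w => {k | w k = 0}) (Set.mapsTo_univ _ _)
    (fun x hx y hy hxy => ?_) Set.finite_univ
  obtain ⟨ε, hε, hmem⟩ := exists_lineMap_mem_nonnegPart hx.1 hy.1 fun k => (Set.ext_iff.1 hxy k).1
  exact ((mem_extremePoints_iff_left.1 hx).2 y hy.1 _ hmem (mem_openSegment_lineMap x y hε)).symm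

theorem isPolytope_nonnegPart (hb : Bornology.IsBounded (nonnegPart L)) :
    IsPolytope (nonnegPart L) :=
  ⟨_, finite_vertexSet_nonnegPart, eq_convexHull_vertexSet_of_isCompact
    (Metric.isCompact_of_isClosed_isBounded isClosed_nonnegPart hb) convex_nonnegPart
    finite_vertexSet_nonnegPart⟩

-- Averaging two points intersects their sets of vanishing coordinates.
theorem exists_forall_apply_eq_zero_of_convex (hF : F.Nonempty) (hc : Convex ℝ F)
    (hnn : ∀ z ∈ F, ∀ k, 0 ≤ z k) :
    ∃ x ∈ F, ∀ z ∈ F, ∀ k, x k = 0 → z k = 0 := by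
  obtain ⟨x, hx, hmin⟩ := exists_minimalFor_of_wellFoundedLT (· ∈ F)
    (fun w => ({k | w k = 0} : Set (Fin m))) hF
  refine ⟨x, hx, fun z hz k hk => ?_⟩
  have hzero : ∀ k, midpoint ℝ x z k = 0 → x k = 0 ∧ z k = 0 := fun k hk => by
    have hxk := hnn x hx k
    have hzk := hnn z hz k
    simp only [midpoint_eq_smul_add, invOf_eq_inv, PiLp.smul_apply, PiLp.add_apply,
      smul_eq_mul] at hk
    constructor <;> linarith
  exact (hzero k (hmin (hc.midpoint_mem hx hz) (fun k hk => (hzero k hk).1) hk)).2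

theorem exists_eq_setOf_apply_eq_zero_of_mem_facetSet (hF : F ∈ facetSet (nonnegPart L)) :
    ∃ k, F = {w ∈ nonnegPart L | w k = 0} := by
  obtain ⟨hne, hexp, hdim⟩ := hF
  have hsub : F ⊆ nonnegPart L := hexp.subset
  obtain ⟨x, hx, hmin⟩ := exists_forall_apply_eq_zero_of_convex hne
    (hexp.convex convex_nonnegPart) fun z hz => (hsub hz).2
  obtain ⟨y, hy, hyF⟩ : ∃ y ∈ nonnegPart L, y ∉ F := by
    by_contra! h
    rw [hsub.antisymm h] at hdim
    omega
  obtain ⟨k, hxk, hyk⟩ : ∃ k, x k = 0 ∧ y k ≠ 0 := by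
    by_contra! h
    obtain ⟨ε, hε, hmem⟩ := exists_lineMap_mem_nonnegPart (hsub hx) hy h
    exact hyF (hexp.isExtreme.left_mem_of_mem_openSegment hy hmem hx
      (mem_openSegment_lineMap x y hε))
  let G := {w ∈ nonnegPart L | w k = 0}
  have hG : IsExposed ℝ (nonnegPart L) G := by
    have := isExposed_setOf_eq (l := -(EuclideanSpace.proj (𝕜 := ℝ) k).toLinearMap) (hsub hx)
      fun z hz => by simpa [hxk] using hz.2 k
    simpa [hxk] using this
  have hFG : F ⊆ G := fun z hz => ⟨hsub hz, hmin z hz k hxk⟩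
  have hlt : polyDim G < polyDim (nonnegPart L) := by
    by_contra! hle
    have hGW : G = nonnegPart L := eq_of_polyDim_le_of_isExposed hG ⟨x, hFG hx⟩ hG.subset
      (Set.Subset.refl _) hle
    exact hyk (hGW.ge hy).2
  exact ⟨k, eq_of_polyDim_le_of_isExposed hexp hne hFG hG.subset
    (Nat.le_of_lt_succ (hlt.trans_eq hdim.symm))⟩

theorem encard_facetSet_nonnegPart_le : (facetSet (nonnegPart L)).encard ≤ m :=
  (Set.encard_le_encard fun _ hF =>
    (exists_eq_setOf_apply_eq_zero_of_mem_facetSet hF).imp fun _ => Eq.symm).trans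
    (encard_range_le fun k : Fin m => {w ∈ nonnegPart L | w k = 0})

end NonnegPart

theorem convexHull_range_eq_image_stdSimplex {𝕜 ι E : Type*} [Field 𝕜] [LinearOrder 𝕜]
    [IsStrictOrderedRing 𝕜] [Fintype ι] [AddCommGroup E] [Module 𝕜 E] (q : ι → E) :
    convexHull 𝕜 (Set.range q) = Fintype.linearCombination 𝕜 q '' stdSimplex 𝕜 ι := by
  classical
  rw [← convexHull_rangle_single_eq_stdSimplex, LinearMap.image_convexHull, ← Set.range_comp]
  congr 2
  ext i
  simp [Fintype.linearCombination_apply_single]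

theorem apply_sum_smul_of_sum_eq_one {𝕜 ι V W : Type*} [Ring 𝕜] [Fintype ι] [AddCommGroup V]
    [Module 𝕜 V] [AddCommGroup W] [Module 𝕜 W] (g : V →ᵃ[𝕜] W) (q : ι → V) {w : ι → 𝕜}
    (hw : ∑ i, w i = 1) : g (∑ i, w i • q i) = ∑ i, w i • g (q i) := by
  rw [← Finset.affineCombination_eq_linear_combination _ _ _ hw,
    Finset.map_affineCombination _ _ _ hw, Finset.affineCombination_eq_linear_combination _ _ _ hw]
  rfl

theorem exists_affineMap_leftInverse_of_injective {𝕜 V W : Type*} [Field 𝕜] [AddCommGroup V]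
    [Module 𝕜 V] [AddCommGroup W] [Module 𝕜 W] {f : V →ᵃ[𝕜] W} (hf : Function.Injective f) :
    ∃ g : W →ᵃ[𝕜] V, Function.LeftInverse g f := by
  obtain ⟨g, hg⟩ := LinearMap.exists_leftInverse_of_injective f.linear
    (LinearMap.ker_eq_bot.2 (f.linear_injective_iff.2 hf))
  refine ⟨g.toAffineMap - AffineMap.const 𝕜 W (g (f 0)), fun x => ?_⟩
  have hx : f x = f.linear x + f 0 := congrFun f.decomp x
  simpa [hx] using LinearMap.congr_fun hg x

theorem isBounded_nonnegPart {m : ℕ} {L : AffineSubspace ℝ (EuclideanSpace ℝ (Fin m))}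
    (hL : ∀ w ∈ L, ∑ k, w k = 1) : Bornology.IsBounded (nonnegPart L) :=
  ((isCompact_stdSimplex ℝ (Fin m)).image (PiLp.continuous_toLp 2 _)).isBounded.subset
    fun w hw => ⟨w.ofLp, ⟨hw.2, hL w hw.1⟩, rfl⟩

-- The extension consists of the convex weights whose combination of the `q k` lies in the section.
theorem IsSectionOf.exists_isExtensionOf_of_range {k d m : ℕ} {P : Set (EuclideanSpace ℝ (Fin k))}
    {q : Fin m → EuclideanSpace ℝ (Fin d)} (h : IsSectionOf P (convexHull ℝ (Set.range q))) :
    ∃ W : Set (EuclideanSpace ℝ (Fin m)), IsExtensionOf W P ∧ (facetSet W).encard ≤ m := by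
  obtain ⟨f, H, hf, hfH⟩ := h
  obtain ⟨g, hg⟩ := exists_affineMap_leftInverse_of_injective hf
  let combination {k : ℕ} (r : Fin m → EuclideanSpace ℝ (Fin k)) :=
    Fintype.linearCombination ℝ r ∘ₗ (WithLp.linearEquiv 2 ℝ (Fin m → ℝ)).toLinearMap
  let total := Fintype.linearCombination ℝ (fun _ => 1 : Fin m → ℝ) ∘ₗ
    (WithLp.linearEquiv 2 ℝ (Fin m → ℝ)).toLinearMap
  let L := H.comap (combination q).toAffineMap ⊓ (affineSpan ℝ {(1 : ℝ)}).comap total.toAffineMap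
  have hL : ∀ w, w ∈ L ↔ ∑ k, w k • q k ∈ H ∧ ∑ k, w k = 1 := fun w => by
    simp [L, combination, total, AffineSubspace.mem_inf_iff, AffineSubspace.mem_comap,
      AffineSubspace.mem_affineSpan_singleton, Fintype.linearCombination_apply]
  have hpoly := isPolytope_nonnegPart (isBounded_nonnegPart fun w hw => ((hL w).1 hw).2)
  have hπ : ∀ w x, ∑ k, w k = 1 → ∑ k, w k • q k = f x → combination (g ∘ q) w = x :=
    fun w x hw hx => calc combination (g ∘ q) w
      _ = ∑ k, w k • g (q k) := by simp [combination, Fintype.linearCombination_apply]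
      _ = g (f x) := by rw [← apply_sum_smul_of_sum_eq_one g q hw, hx]
      _ = x := hg x
  refine ⟨nonnegPart L, ⟨hpoly, combination (g ∘ q), ?_⟩, encard_facetSet_nonnegPart_le⟩
  rw [convexHull_range_eq_image_stdSimplex] at hfH
  ext x
  constructor
  · rintro ⟨w, ⟨hw, hnn⟩, rfl⟩
    obtain ⟨hH, hsum⟩ := (hL w).1 hw
    obtain ⟨x, hx, hfx⟩ := hfH.ge ⟨⟨w.ofLp, ⟨hnn, hsum⟩, rfl⟩, hH⟩
    exact (hπ w x hsum hfx.symm) ▸ hx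
  · intro hx
    obtain ⟨⟨w, hw, hwx⟩, hH⟩ := hfH.le (Set.mem_image_of_mem f hx)
    rw [← hwx] at hH
    have hwL : WithLp.toLp 2 w ∈ L := (hL _).2 ⟨hH, hw.2⟩
    exact ⟨WithLp.toLp 2 w, ⟨hwL, hw.1⟩, hπ _ x hw.2 hwx⟩

theorem IsSectionOf.exists_isExtensionOf {k d : ℕ} {P : Set (EuclideanSpace ℝ (Fin k))}
    {Q : Set (EuclideanSpace ℝ (Fin d))} (h : IsSectionOf P Q) (hQ : IsPolytope Q) :
    ∃ (m : ℕ) (W : Set (EuclideanSpace ℝ (Fin m))), IsExtensionOf W P ∧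
      (facetSet W).encard ≤ (vertexSet Q).encard := by
  obtain ⟨m, q, hinj, hq⟩ := hQ.finite_vertexSet.fin_param
  rw [hQ.eq_convexHull_vertexSet, ← hq] at h
  obtain ⟨W, hW, hcard⟩ := h.exists_isExtensionOf_of_range
  refine ⟨m, W, hW, hcard.trans_eq ?_⟩
  rw [← hq, ← Set.image_univ, hinj.encard_image]
  simp

section Crossing

variable {𝕜 E : Type*} [Field 𝕜] [AddCommGroup E] [Module 𝕜 E]

/-- The point in which the line through `a` and `b` meets the kernel of `h`, when `h a ≠ h b`. -/
def crossing (h : E →ₗ[𝕜] 𝕜) (a b : E) : E := (h a - h b)⁻¹ • (h a • b - h b • a)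

theorem crossing_neg_swap (h : E →ₗ[𝕜] 𝕜) (a b : E) : crossing (-h) b a = crossing h a b := by
  rw [crossing, crossing, LinearMap.neg_apply, LinearMap.neg_apply, neg_sub_neg, neg_smul, neg_smul]
  congr 1
  abel

theorem map_crossing (h : E →ₗ[𝕜] 𝕜) (a b : E) : h (crossing h a b) = 0 := by
  simp [crossing, mul_comm]

variable [LinearOrder 𝕜] [IsStrictOrderedRing 𝕜] {h : E →ₗ[𝕜] 𝕜} {S T : Set E} {a b x : E}

theorem sub_smul_crossing (ha : 0 < h a) (hb : h b < 0) :
    (h a - h b) • crossing h a b = h a • b - h b • a :=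
  smul_inv_smul₀ (sub_pos.2 (hb.trans ha)).ne' _

theorem crossing_mem_segment (ha : 0 < h a) (hb : h b < 0) : crossing h a b ∈ segment 𝕜 a b := by
  have hab : 0 < h a - h b := sub_pos.2 (hb.trans ha)
  refine ⟨-h b / (h a - h b), h a / (h a - h b), div_nonneg (neg_nonneg.2 hb.le) hab.le,
    div_nonneg ha.le hab.le, ?_, ?_⟩
  · field_simp
    ring
  · rw [crossing]
    module

theorem eq_crossing_of_mem_segment (ha : 0 < h a) (hb : h b < 0) (hx : x ∈ segment 𝕜 a b)
    (h0 : h x = 0) : x = crossing h a b := by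
  obtain ⟨s, t, -, -, hst, rfl⟩ := hx
  simp only [map_add, map_smul, smul_eq_mul] at h0
  have hab : h a - h b ≠ 0 := (sub_pos.2 (hb.trans ha)).ne'
  have ht : t = h a / (h a - h b) := by
    rw [eq_div_iff hab]
    linear_combination h a * hst - h0
  have hs : s = -h b / (h a - h b) := by
    rw [eq_div_iff hab]
    linear_combination h0 - h b * hst
  rw [hs, ht, crossing]
  module

theorem convex_setOf_crossing_mem {K : Set E} (hK : Convex 𝕜 K) (hb : h b < 0) :
    Convex 𝕜 {a | 0 < h a ∧ crossing h a b ∈ K} := by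
  rintro x ⟨hx, hxK⟩ y ⟨hy, hyK⟩ s t hs ht hst
  have hpos : 0 < h (s • x + t • y) := convex_halfSpace_gt h.isLinear 0 hx hy hs ht hst
  refine ⟨hpos, ?_⟩
  have hsum : s * (h x - h b) + t * (h y - h b) = h (s • x + t • y) - h b := by
    simp only [map_add, map_smul, smul_eq_mul]
    linear_combination h b * -hst
  have hmem := convex_iff_div.1 hK hxK hyK (mul_nonneg hs (sub_pos.2 (hb.trans hx)).le)
    (mul_nonneg ht (sub_pos.2 (hb.trans hy)).le) (hsum ▸ sub_pos.2 (hb.trans hpos))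
  convert hmem using 1
  rw [hsum, div_eq_inv_mul, div_eq_inv_mul, mul_smul, mul_smul, mul_smul, mul_smul,
    sub_smul_crossing hx hb, sub_smul_crossing hy hb, crossing, map_add, map_smul, map_smul]
  module

theorem crossing_mem_of_mem_convexHull {K : Set E} (hK : Convex 𝕜 K) (hS : ∀ a ∈ S, 0 < h a)
    (hT : ∀ b ∈ T, h b < 0) (hST : ∀ a ∈ S, ∀ b ∈ T, crossing h a b ∈ K)
    (ha : a ∈ convexHull 𝕜 S) (hb : b ∈ convexHull 𝕜 T) : crossing h a b ∈ K := by
  have hleft : ∀ b ∈ T, ∀ a ∈ convexHull 𝕜 S, 0 < h a ∧ crossing h a b ∈ K := fun b hb =>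
    convexHull_min (fun a ha => ⟨hS a ha, hST a ha b hb⟩) (convex_setOf_crossing_mem hK (hT b hb))
  have hha : 0 < h a := convexHull_min hS (convex_halfSpace_gt h.isLinear 0) ha
  have hright : convexHull 𝕜 T ⊆ {b | 0 < (-h) b ∧ crossing (-h) b a ∈ K} :=
    convexHull_min (fun b hb => ⟨neg_pos.2 (hT b hb), (crossing_neg_swap h a b).symm ▸
      (hleft b hb a ha).2⟩) (convex_setOf_crossing_mem hK (neg_neg_of_pos hha))
  exact crossing_neg_swap h a b ▸ (hright hb).2

theorem convexHull_union_inter_ker (hS : ∀ a ∈ S, 0 < h a) (hT : ∀ b ∈ T, h b < 0) :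
    convexHull 𝕜 (S ∪ T) ∩ LinearMap.ker h = convexHull 𝕜 (Set.image2 (crossing h) S T) := by
  have hS' : ∀ a ∈ convexHull 𝕜 S, 0 < h a := convexHull_min hS (convex_halfSpace_gt h.isLinear 0)
  have hT' : ∀ b ∈ convexHull 𝕜 T, h b < 0 := convexHull_min hT (convex_halfSpace_lt h.isLinear 0)
  refine Set.Subset.antisymm ?_ ?_
  · rintro x ⟨hx, h0⟩
    rcases S.eq_empty_or_nonempty with rfl | hSne
    · rw [Set.empty_union] at hx
      exact absurd h0 (hT' x hx).ne
    rcases T.eq_empty_or_nonempty with rfl | hTne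
    · rw [Set.union_empty] at hx
      exact absurd h0 (hS' x hx).ne'
    rw [convexHull_union hSne hTne] at hx
    obtain ⟨a, ha, b, hb, hx⟩ := mem_convexJoin.1 hx
    rw [eq_crossing_of_mem_segment (hS' a ha) (hT' b hb) hx h0]
    exact crossing_mem_of_mem_convexHull (convex_convexHull 𝕜 _) hS hT
      (fun a ha b hb => subset_convexHull 𝕜 _ (Set.mem_image2_of_mem ha hb)) ha hb
  · refine convexHull_min ?_ ((convex_convexHull 𝕜 _).inter (LinearMap.ker h).convex)
    rintro _ ⟨a, ha, b, hb, rfl⟩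
    exact ⟨segment_subset_convexHull (.inl ha) (.inr hb) (crossing_mem_segment (hS a ha) (hT b hb)),
      map_crossing h a b⟩

end Crossing

section Dehomogenization

open scoped Pointwise

theorem exists_forall_add_singleton_pos {𝕜 E : Type*} [Field 𝕜] [LinearOrder 𝕜]
    [IsStrictOrderedRing 𝕜] [AddCommGroup E] {A B : Set (𝕜 × E)} (hA : A.Finite) (hB : B.Finite)
    (hAB : ∀ v ∈ A + B, 0 < v.1) :
    ∃ u : 𝕜 × E, (∀ v ∈ A + {-u}, 0 < v.1) ∧ ∀ v ∈ B + {u}, 0 < v.1 := by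
  lift A to Finset (𝕜 × E) using hA
  lift B to Finset (𝕜 × E) using hB
  obtain ⟨σ, hσB, hσA⟩ := Order.exists_between_finsets (B.image fun b => -b.1) (A.image Prod.fst)
    (by
      simp only [Finset.forall_mem_image]
      exact fun b hb a ha => neg_lt_iff_pos_add.2 (hAB _ (Set.add_mem_add ha hb)))
  rw [Finset.forall_mem_image] at hσA hσB
  simp only [Set.add_singleton, Set.forall_mem_image]
  exact ⟨(σ, 0), fun a ha => (sub_pos.2 (hσA ha)).trans_eq (sub_eq_add_neg a.1 σ),
    fun b hb => neg_lt_iff_pos_add'.1 (hσB hb)⟩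

variable {𝕜 E F : Type*} [Field 𝕜] [AddCommGroup E] [Module 𝕜 E] [AddCommGroup F] [Module 𝕜 F]

/-- The point of `E` with homogeneous coordinates `v` (and `0` when `v` lies at infinity). -/
def dehomog (v : 𝕜 × E) : E := v.1⁻¹ • v.2

/-- The point with homogeneous coordinates `v`, embedded by `ι` and then raised in the direction `e`
by the reciprocal of the weight of `v`. -/
def dehomogLift (ι : E →ₗ[𝕜] F) (e : F) (v : 𝕜 × E) : F := ι (dehomog v) + v.1⁻¹ • e

theorem map_dehomogLift {ι : E →ₗ[𝕜] F} {h : F →ₗ[𝕜] 𝕜} (hι : ∀ x, h (ι x) = 0) (e : F)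
    (v : 𝕜 × E) : h (dehomogLift ι e v) = v.1⁻¹ * h e := by
  rw [dehomogLift, map_add, hι, zero_add, map_smul, smul_eq_mul]

theorem crossing_dehomogLift {ι : E →ₗ[𝕜] F} {h : F →ₗ[𝕜] 𝕜} (hι : ∀ x, h (ι x) = 0) {e : F}
    (he : h e = 1) {a b : 𝕜 × E} (ha : a.1 ≠ 0) (hb : b.1 ≠ 0) (hab : a.1 + b.1 ≠ 0) :
    crossing h (dehomogLift ι e a) (dehomogLift ι (-e) b) = ι (dehomog (a + b)) := by
  rw [crossing, map_dehomogLift hι, map_dehomogLift hι, map_neg, he]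
  simp only [dehomogLift, dehomog, Prod.fst_add, Prod.snd_add, map_smul, map_add]
  have hsub : a.1⁻¹ * 1 - b.1⁻¹ * -1 = (a.1 + b.1) / (a.1 * b.1) := by
    field_simp
    ring
  rw [hsub, inv_div]
  match_scalars <;> field_simp
  ring

theorem image_convexHull_dehomog_add [LinearOrder 𝕜] [IsStrictOrderedRing 𝕜]
    {A B : Set (𝕜 × E)} {ι : E →ₗ[𝕜] F} {h : F →ₗ[𝕜] 𝕜} (hι : ∀ x, h (ι x) = 0)
    {e : F} (he : h e = 1) (hA : ∀ a ∈ A, 0 < a.1) (hB : ∀ b ∈ B, 0 < b.1) :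
    ι '' convexHull 𝕜 (dehomog '' (A + B)) =
      convexHull 𝕜 (dehomogLift ι e '' A ∪ dehomogLift ι (-e) '' B) ∩ LinearMap.ker h := by
  have hApos : ∀ x ∈ dehomogLift ι e '' A, 0 < h x := by
    rintro _ ⟨a, ha, rfl⟩
    simpa [map_dehomogLift hι, he] using hA a ha
  have hBneg : ∀ x ∈ dehomogLift ι (-e) '' B, h x < 0 := by
    rintro _ ⟨b, hb, rfl⟩
    simpa [map_dehomogLift hι, he] using hB b hb
  rw [convexHull_union_inter_ker hApos hBneg, LinearMap.image_convexHull, ← Set.image2_add,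
    Set.image_image2, Set.image_image2, Set.image2_image_left, Set.image2_image_right]
  congr 1
  exact Set.image2_congr fun a ha b hb =>
    (crossing_dehomogLift hι he (hA a ha).ne' (hB b hb).ne' (add_pos (hA a ha) (hB b hb)).ne').symm

theorem exists_injective_and_map_eq_zero {k d : ℕ} (hkd : k < d) :
    ∃ (ι : EuclideanSpace ℝ (Fin k) →ₗ[ℝ] EuclideanSpace ℝ (Fin d))
      (h : EuclideanSpace ℝ (Fin d) →ₗ[ℝ] ℝ) (e : EuclideanSpace ℝ (Fin d)),
      Function.Injective ι ∧ (∀ x, h (ι x) = 0) ∧ h e = 1 := by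
  obtain ⟨ι, hι⟩ := Module.Free.exists_linearMap_injective_of_rank_lt
    (R := ℝ) (M := EuclideanSpace ℝ (Fin k)) (N := EuclideanSpace ℝ (Fin d))
    (by simpa [← Module.finrank_eq_rank] using hkd)
  have hlt : LinearMap.range ι < ⊤ := by
    refine Submodule.lt_top_of_finrank_lt_finrank ?_
    rwa [LinearMap.finrank_range_of_inj hι, finrank_euclideanSpace_fin, finrank_euclideanSpace_fin]
  obtain ⟨h, hh, hle⟩ := Submodule.exists_le_ker_of_lt_top _ hlt
  obtain ⟨e, he⟩ := DFunLike.ne_iff.1 hh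
  exact ⟨ι, h, (h e)⁻¹ • e, hι, fun x => hle (LinearMap.mem_range_self ι x),
    by simpa using inv_mul_cancel₀ he⟩

theorem polyDim_lt_polyDim {k d : ℕ} {P : Set (EuclideanSpace ℝ (Fin k))}
    {Q : Set (EuclideanSpace ℝ (Fin d))}
    {ι : EuclideanSpace ℝ (Fin k) →ₗ[ℝ] EuclideanSpace ℝ (Fin d)}
    {h : EuclideanSpace ℝ (Fin d) →ₗ[ℝ] ℝ} (hinj : Function.Injective ι) (hι : ∀ x, h (ι x) = 0)
    (hP : P.Nonempty) (hPQ : ι '' P ⊆ Q) {y : EuclideanSpace ℝ (Fin d)} (hy : y ∈ Q)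
    (hhy : h y ≠ 0) : polyDim P < polyDim Q := by
  obtain ⟨x, hx⟩ := hP
  have hmap : (vectorSpan ℝ P).map ι = vectorSpan ℝ (ι '' P) :=
    ι.toAffineMap.map_vectorSpan
  rw [polyDim, polyDim, (Submodule.equivMapOfInjective ι hinj (vectorSpan ℝ P)).finrank_eq]
  refine Submodule.finrank_lt_finrank_of_lt (SetLike.lt_iff_le_and_exists.2
    ⟨hmap ▸ vectorSpan_mono ℝ hPQ, y - ι x, vsub_mem_vectorSpan ℝ hy (hPQ ⟨x, hx, rfl⟩), ?_⟩)
  rintro ⟨z, -, hz⟩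
  exact hhy (by simpa [hι] using (congrArg h hz).symm)

theorem exists_isSectionOf_convexHull_dehomog_add {k d : ℕ} (hkd : k < d)
    {A B : Set (ℝ × EuclideanSpace ℝ (Fin k))} (hA : A.Finite) (hB : B.Finite) (hA₀ : A.Nonempty)
    (hB₀ : B.Nonempty) (hAB : ∀ v ∈ A + B, 0 < v.1) {P : Set (EuclideanSpace ℝ (Fin k))}
    (hP : P = convexHull ℝ (dehomog '' (A + B))) :
    ∃ Q : Set (EuclideanSpace ℝ (Fin d)), IsPolytope Q ∧ polyDim P < polyDim Q ∧
      (vertexSet Q).encard ≤ A.encard + B.encard ∧ IsSectionOf P Q := by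
  obtain ⟨ι, h, e, hinj, hι, he⟩ := exists_injective_and_map_eq_zero hkd
  obtain ⟨u, hAu, hBu⟩ := exists_forall_add_singleton_pos hA hB hAB
  have hsum : A + {-u} + (B + {u}) = A + B := by
    rw [add_add_add_comm, Set.singleton_add_singleton, neg_add_cancel, Set.singleton_zero, add_zero]
  have hsec := image_convexHull_dehomog_add hι he hAu hBu
  rw [hsum, ← hP] at hsec
  have hne : P.Nonempty := hP ▸ ((hA₀.add hB₀).image _).convexHull
  obtain ⟨a, ha⟩ := hA₀.add (Set.singleton_nonempty (-u))
  have hpos : h (dehomogLift ι e a) ≠ 0 := by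
    rw [map_dehomogLift hι, he, mul_one]
    exact (inv_pos.2 (hAu a ha)).ne'
  refine ⟨_, ⟨_, ((hA.add (Set.finite_singleton _)).image _).union
    ((hB.add (Set.finite_singleton _)).image _), rfl⟩,
    polyDim_lt_polyDim hinj hι hne (hsec.trans_subset Set.inter_subset_left)
      (subset_convexHull ℝ _ (.inl (Set.mem_image_of_mem _ ha))) hpos,
    ?_, ι.toAffineMap, (LinearMap.ker h).toAffineSubspace, hinj, hsec⟩
  refine encard_vertexSet_convexHull_le.trans ((Set.encard_union_le _ _).trans (add_le_add ?_ ?_))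
  all_goals
    rw [Set.add_singleton]
    exact (Set.encard_image_le _ _).trans (Set.encard_image_le _ _)

end Dehomogenization

theorem inv_smul_add_add_mem_convexHull {𝕜 E : Type*} [Field 𝕜] [LinearOrder 𝕜]
    [IsStrictOrderedRing 𝕜] [AddCommGroup E] [Module 𝕜 E] {a b c : E} {r s t : 𝕜} (hr : 0 ≤ r)
    (hs : 0 ≤ s) (ht : 0 ≤ t) (h : 0 < r + s + t) :
    (r + s + t)⁻¹ • (r • a + s • b + t • c) ∈ convexHull 𝕜 {a, b, c} := by
  have := (convex_convexHull 𝕜 {a, b, c}).centerMass_mem (t := Finset.univ) (w := ![r, s, t])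
    (z := ![a, b, c]) (fun i _ => by fin_cases i <;> assumption)
    (by simpa [Fin.sum_univ_three] using h)
    (fun i _ => subset_convexHull 𝕜 _ (by fin_cases i <;> simp))
  simpa only [Finset.centerMass, Fin.sum_univ_three, Matrix.cons_val] using this

section Orientation

variable {a b c d x : EuclideanSpace ℝ (Fin 2)}

/-- Twice the signed area of the triangle `a b c`, which is positive when the triangle is traversed
counterclockwise. -/
def orient (a b c : EuclideanSpace ℝ (Fin 2)) : ℝ :=
  (b 0 - a 0) * (c 1 - a 1) - (b 1 - a 1) * (c 0 - a 0)

theorem orient_rotate (a b c : EuclideanSpace ℝ (Fin 2)) : orient b c a = orient a b c := by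
  simp only [orient]; ring

theorem orient_swap_right (a b c : EuclideanSpace ℝ (Fin 2)) : orient a c b = -orient a b c := by
  simp only [orient]; ring

theorem orient_swap_left (a b c : EuclideanSpace ℝ (Fin 2)) : orient b a c = -orient a b c := by
  simp only [orient]; ring

theorem orient_self_left (a b : EuclideanSpace ℝ (Fin 2)) : orient a a b = 0 := by
  simp only [orient]; ring

theorem orient_self_right (a b : EuclideanSpace ℝ (Fin 2)) : orient a b b = 0 := by
  simp only [orient]; ring

theorem orient_self_outer (a b : EuclideanSpace ℝ (Fin 2)) : orient a b a = 0 := by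
  simp only [orient]; ring

-- The Grassmann–Plücker relation.
theorem orient_mul_orient (a b c d e : EuclideanSpace ℝ (Fin 2)) :
    orient a b d * orient a c e = orient a b c * orient a d e + orient a b e * orient a c d := by
  simp only [orient]; ring

theorem orient_add_orient_add_orient (a b c x : EuclideanSpace ℝ (Fin 2)) :
    orient b c x + orient c a x + orient a b x = orient a b c := by
  simp only [orient]; ring

theorem orient_smul_add_orient_smul_add_orient_smul (a b c x : EuclideanSpace ℝ (Fin 2)) :
    orient b c x • a + orient c a x • b + orient a b x • c = orient a b c • x := by
  ext i
  simp only [PiLp.add_apply, PiLp.smul_apply, smul_eq_mul, orient]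
  fin_cases i <;> simp only [Fin.zero_eta, Fin.mk_one] <;> ring

/-- The affine functional `orient a b`, whose zero set is the line through `a` and `b`. -/
noncomputable def orientAffine (a b : EuclideanSpace ℝ (Fin 2)) :
    EuclideanSpace ℝ (Fin 2) →ᵃ[ℝ] ℝ where
  toFun := orient a b
  linear := (b 0 - a 0) • (EuclideanSpace.proj (𝕜 := ℝ) 1).toLinearMap -
    (b 1 - a 1) • (EuclideanSpace.proj (𝕜 := ℝ) 0).toLinearMap
  map_vadd' x v := by simp [orient]; ring

@[simp]
theorem orientAffine_apply (a b x : EuclideanSpace ℝ (Fin 2)) :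
    orientAffine a b x = orient a b x := rfl

theorem convex_setOf_orient_nonneg (a b : EuclideanSpace ℝ (Fin 2)) :
    Convex ℝ {x | 0 ≤ orient a b x} :=
  (convex_Ici (0 : ℝ)).affine_preimage (orientAffine a b)

theorem orient_lineMap_midpoint (a b x : EuclideanSpace ℝ (Fin 2)) (t : ℝ) :
    orient a b (AffineMap.lineMap x (midpoint ℝ a b) (1 + t)) = -(t * orient a b x) := by
  have h : orientAffine a b (midpoint ℝ a b) = 0 := by
    rw [AffineMap.map_midpoint, orientAffine_apply, orientAffine_apply, orient_self_outer,
      orient_self_right, midpoint_self]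
  rw [← orientAffine_apply, AffineMap.apply_lineMap, h, AffineMap.lineMap_apply_module,
    orientAffine_apply]
  simp

theorem mem_convexHull_of_orient_nonneg (h : 0 < orient a b c) (ha : 0 ≤ orient b c x)
    (hb : 0 ≤ orient c a x) (hc : 0 ≤ orient a b x) : x ∈ convexHull ℝ {a, b, c} := by
  have hsum := orient_add_orient_add_orient a b c x
  have := inv_smul_add_add_mem_convexHull (a := a) (b := b) (c := c) ha hb hc (hsum ▸ h)
  rwa [hsum, orient_smul_add_orient_smul_add_orient_smul, inv_smul_smul₀ h.ne'] at this

theorem collinear_of_orient_eq_zero (h : orient a b c = 0) : Collinear ℝ {a, b, c} := by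
  rcases eq_or_ne b a with rfl | hba
  · simpa using collinear_pair ℝ b c
  have hd : (b 0 - a 0) ^ 2 + (b 1 - a 1) ^ 2 ≠ 0 := fun hd => hba <| by
    ext i
    fin_cases i <;> simp only [Fin.zero_eta, Fin.mk_one] <;> nlinarith
  have hc : c = a + (((c 0 - a 0) * (b 0 - a 0) + (c 1 - a 1) * (b 1 - a 1)) /
      ((b 0 - a 0) ^ 2 + (b 1 - a 1) ^ 2)) • (b - a) := by
    unfold orient at h
    ext i
    fin_cases i <;> simp <;> field_simp
    · linear_combination (-(b 1 - a 1)) * h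
    · linear_combination (b 0 - a 0) * h
  rw [hc]
  refine (collinear_iff_of_mem (Set.mem_insert a _)).2 ⟨b - a, ?_⟩
  simp only [Set.mem_insert_iff, Set.mem_singleton_iff, forall_eq_or_imp, forall_eq]
  exact ⟨⟨0, by simp⟩, ⟨1, by simp⟩, ⟨_, by rw [vadd_eq_add, add_comm]⟩⟩

end Orientation

section HomogeneousCoordinates

variable {a b c d x : EuclideanSpace ℝ (Fin 2)} {l m : ℝ}

/-- The point `x` in homogeneous coordinates, normalized to weight `1`. -/
def homog (x : EuclideanSpace ℝ (Fin 2)) : ℝ × EuclideanSpace ℝ (Fin 2) := (1, x)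

theorem dehomog_smul_homog (hl : l ≠ 0) : dehomog (l • homog x) = x := by
  simp [dehomog, homog, hl]

theorem homog_relation (a : EuclideanSpace ℝ (Fin 2)) (h : orient b c d ≠ 0) :
    (orient a c d / orient b c d) • homog b + (orient a b c / orient b c d) • homog d - homog a =
      (orient a b d / orient b c d) • homog c := by
  have hsum := orient_add_orient_add_orient b c d a
  have hx := orient_smul_add_orient_smul_add_orient_smul b c d a
  rw [orient_rotate a c d, orient_rotate a d b, orient_rotate a b c,
    orient_swap_right a b d] at hsum hx
  ext : 1
  · simp only [homog, Prod.smul_mk, smul_eq_mul, mul_one, Prod.mk_add_mk, Prod.mk_sub_mk]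
    field_simp
    linear_combination hsum
  · rw [← smul_right_inj h]
    simp only [homog, Prod.smul_mk, Prod.mk_add_mk, Prod.mk_sub_mk, smul_sub, smul_add, smul_smul,
      mul_div_cancel₀ _ h]
    rw [← hx]
    module

theorem dehomog_mem_convexHull (hbcd : 0 < orient b c d) (habd : 0 < orient a b d)
    (hl : orient a c d ≤ l * orient b c d) (hm : orient a b c ≤ m * orient b c d) :
    0 < (l • homog b + m • homog d - homog a).1 ∧
      dehomog (l • homog b + m • homog d - homog a) ∈ convexHull ℝ {b, c, d} := by
  have hv : l • homog b + m • homog d - homog a = (l - orient a c d / orient b c d) • homog b +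
      (orient a b d / orient b c d) • homog c + (m - orient a b c / orient b c d) • homog d := by
    rw [← homog_relation a hbcd.ne']
    module
  have hb := sub_nonneg.2 ((div_le_iff₀ hbcd).2 hl)
  have hc := div_pos habd hbcd
  have hd := sub_nonneg.2 ((div_le_iff₀ hbcd).2 hm)
  have hpos := add_pos_of_pos_of_nonneg (add_pos_of_nonneg_of_pos hb hc) hd
  have hmem := inv_smul_add_add_mem_convexHull (a := b) (b := c) (c := d) hb hc.le hd hpos
  rw [hv]
  simpa [dehomog, homog] using And.intro hpos hmem

end HomogeneousCoordinates

section ConvexPolygons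

/-- The points `p 0, …, p (n - 1)` are, in this order, the vertices of a convex polygon traversed
counterclockwise. -/
def IsConvexPolygon {n : ℕ} (p : Fin n → EuclideanSpace ℝ (Fin 2)) : Prop :=
  ∀ i j k, i < j → j < k → 0 < orient (p i) (p j) (p k)

/-- The reflection of the plane in the second coordinate axis. -/
noncomputable def mirror (x : EuclideanSpace ℝ (Fin 2)) : EuclideanSpace ℝ (Fin 2) :=
  !₂[-x 0, x 1]

theorem orient_mirror (a b c : EuclideanSpace ℝ (Fin 2)) :
    orient (mirror a) (mirror b) (mirror c) = orient a c b := by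
  simp [orient, mirror]; ring

theorem sbtw_self_add_one {n : ℕ} [NeZero n] {i j : Fin n} (hij : i ≠ j) (hij' : i ≠ j + 1) :
    sbtw j (j + 1) i := by
  simp only [Fin.sbtw_iff, Fin.lt_def, ne_eq, Fin.ext_iff, Fin.val_add_eq_ite, Fin.val_one'] at *
  have := i.isLt
  have := j.isLt
  rcases (by omega : n = 1 ∨ 1 < n) with rfl | hn
  · omega
  · rw [Nat.mod_eq_of_lt hn] at *
    split_ifs at * <;> omega

theorem sbtw_add_left {n : ℕ} (r : Fin n) {i j k : Fin n} (hij : i < j) (hjk : j < k) :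
    sbtw (r + i) (r + j) (r + k) := by
  simp only [Fin.sbtw_iff, Fin.lt_def, Fin.val_add_eq_ite] at *
  split_ifs <;> omega

theorem sbtw_neg {n : ℕ} [NeZero n] {i j k : Fin n} (hij : i < j) (hjk : j < k) :
    sbtw (-i) (-k) (-j) := by
  simp only [Fin.sbtw_iff, Fin.lt_def, Fin.val_neg, Fin.ext_iff, Fin.val_zero] at *
  split_ifs <;> omega

namespace IsConvexPolygon

variable {n : ℕ} {p : Fin n → EuclideanSpace ℝ (Fin 2)}

theorem orient_pos (hp : IsConvexPolygon p) {i j k : Fin n} (h : sbtw i j k) :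
    0 < orient (p i) (p j) (p k) := by
  rcases Fin.sbtw_iff.1 h with ⟨hij, hjk⟩ | ⟨hjk, hki⟩ | ⟨hki, hij⟩
  · exact hp _ _ _ hij hjk
  · exact orient_rotate (p i) (p j) (p k) ▸ hp _ _ _ hjk hki
  · exact orient_rotate (p k) (p i) (p j) ▸ hp _ _ _ hki hij

theorem comp_add_left (hp : IsConvexPolygon p) (r : Fin n) : IsConvexPolygon fun i => p (r + i) :=
  fun _ _ _ hij hjk => hp.orient_pos (sbtw_add_left r hij hjk)

theorem orient_self_add_pos [NeZero n] (hp : IsConvexPolygon p) (r : Fin n) {i j : Fin n}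
    (hi : 0 < i) (hij : i < j) : 0 < orient (p r) (p (r + i)) (p (r + j)) := by
  simpa using hp.orient_pos (sbtw_add_left r hi hij)

theorem mirror_comp_neg [NeZero n] (hp : IsConvexPolygon p) :
    IsConvexPolygon fun i => mirror (p (-i)) := by
  intro i j k hij hjk
  rw [orient_mirror]
  exact hp.orient_pos (sbtw_neg hij hjk)

variable [NeZero n]

theorem orient_edge_pos (hp : IsConvexPolygon p) {i j : Fin n} (hij : i ≠ j) (hij' : i ≠ j + 1) :
    0 < orient (p j) (p (j + 1)) (p i) :=
  hp.orient_pos (sbtw_self_add_one hij hij')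

theorem convexHull_range_subset (hp : IsConvexPolygon p) (j : Fin n) :
    convexHull ℝ (Set.range p) ⊆ {x | 0 ≤ orient (p j) (p (j + 1)) x} := by
  refine convexHull_min ?_ (convex_setOf_orient_nonneg _ _)
  rintro _ ⟨i, rfl⟩
  change 0 ≤ orient _ _ _
  rcases eq_or_ne i j with rfl | hij
  · rw [orient_self_outer]
  rcases eq_or_ne i (j + 1) with rfl | hij'
  · rw [orient_self_right]
  · exact (hp.orient_edge_pos hij hij').le

theorem eq_or_eq_of_lineMap_midpoint_mem (hp : IsConvexPolygon p) {i j : Fin n} {ε : ℝ}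
    (hε : 0 < ε) (h : AffineMap.lineMap (p i) (midpoint ℝ (p j) (p (j + 1))) (1 + ε) ∈
      convexHull ℝ (Set.range p)) : i = j ∨ i = j + 1 := by
  by_contra! hij
  have := hp.convexHull_range_subset j h
  change 0 ≤ orient _ _ _ at this
  rw [orient_lineMap_midpoint] at this
  have := mul_pos hε (hp.orient_edge_pos hij.1 hij.2)
  linarith

theorem exists_isPolygonalFamily (hp : IsConvexPolygon p) {d : ℕ}
    {Q : Set (EuclideanSpace ℝ (Fin d))} (hQ : IsExtensionOf Q (convexHull ℝ (Set.range p)))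
    [Finite (facetSet Q)] [DecidableEq (facetSet Q)] :
    ∃ B : Fin n → Finset (facetSet Q), IsPolygonalFamily B := by
  classical
  have := Fintype.ofFinite (facetSet Q)
  obtain ⟨hQ, π, hπ⟩ := hQ
  have hlift (i : Fin n) : ∃ y ∈ Q, π y = p i :=
    hπ.ge (subset_convexHull ℝ _ (Set.mem_range_self i))
  choose y hy hyp using hlift
  refine ⟨fun i => {F | y i ∈ F.1}, fun i j h => ?_⟩
  obtain ⟨ε, hε, hmem⟩ := hQ.exists_lineMap_mem (hQ.convex.midpoint_mem (hy j) (hy (j + 1))) (hy i)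
    fun F hF hmid => by
      have hopen := midpoint_mem_openSegment (𝕜 := ℝ) (y j) (y (j + 1))
      have hj := hF.2.1.isExtreme.left_mem_of_mem_openSegment (hy j) (hy (j + 1)) hmid hopen
      have hj' := hF.2.1.isExtreme.right_mem_of_mem_openSegment (hy j) (hy (j + 1)) hmid hopen
      simpa using @h ⟨F, hF⟩ (by simp [hj, hj'])
  have := hπ.le (Set.mem_image_of_mem π hmem)
  rw [← LinearMap.coe_toAffineMap, AffineMap.apply_lineMap, AffineMap.map_midpoint] at this
  simp only [LinearMap.coe_toAffineMap, hyp] at this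
  exact hp.eq_or_eq_of_lineMap_midpoint_mem hε this

end IsConvexPolygon

theorem IsConvexPolygon.six_le_encard_facetSet {p : Fin 7 → EuclideanSpace ℝ (Fin 2)}
    (hp : IsConvexPolygon p) {d : ℕ} {Q : Set (EuclideanSpace ℝ (Fin d))}
    (hQ : IsExtensionOf Q (convexHull ℝ (Set.range p))) : 6 ≤ (facetSet Q).encard := by
  classical
  rcases (facetSet Q).finite_or_infinite with hfin | hinf
  · have := hfin.fintype
    obtain ⟨B, hB⟩ := hp.exists_isPolygonalFamily hQ
    rw [Set.encard_eq_coe_toFinset_card, Set.toFinset_card]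
    exact_mod_cast hB.six_le_card
  · simp [hinf.encard_eq]

theorem IsConvexPolygon.six_le_encard_vertexSet {p : Fin 7 → EuclideanSpace ℝ (Fin 2)}
    (hp : IsConvexPolygon p) {d : ℕ} {Q : Set (EuclideanSpace ℝ (Fin d))} (hQ : IsPolytope Q)
    (h : IsSectionOf (convexHull ℝ (Set.range p)) Q) : 6 ≤ (vertexSet Q).encard := by
  obtain ⟨m, W, hW, hcard⟩ := h.exists_isExtensionOf hQ
  exact (hp.six_le_encard_facetSet hW).trans hcard

end ConvexPolygons

section VertexOrder

variable {P : Set (EuclideanSpace ℝ (Fin 2))} {a b c d : EuclideanSpace ℝ (Fin 2)}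

theorem notMem_convexHull_of_mem_vertexSet (hP : Convex ℝ P) {s : Set (EuclideanSpace ℝ (Fin 2))}
    (ha : a ∈ vertexSet P) (hs : s ⊆ P) (has : a ∉ s) : a ∉ convexHull ℝ s := fun h =>
  (hP.mem_extremePoints_iff_mem_sdiff_convexHull_sdiff.1 ha).2 <|
    convexHull_mono (Set.subset_sdiff_singleton hs has) h

theorem orient_ne_zero_of_mem_vertexSet (ha : a ∈ vertexSet P) (hb : b ∈ vertexSet P)
    (hc : c ∈ vertexSet P) (hab : a ≠ b) (hac : a ≠ c) (hbc : b ≠ c) : orient a b c ≠ 0 := by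
  have not_wbtw {x y z : EuclideanSpace ℝ (Fin 2)} (hx : x ∈ vertexSet P) (hy : y ∈ vertexSet P)
      (hz : z ∈ vertexSet P) (hxy : x ≠ y) (hyz : y ≠ z) : ¬ Wbtw ℝ x y z := fun h =>
    ((mem_extremePoints_iff_forall_segment.1 hy).2 x hx.1 z hz.1 h.mem_segment).elim hxy hyz.symm
  intro h
  rcases (collinear_of_orient_eq_zero h).wbtw_or_wbtw_or_wbtw with h | h | h
  exacts [not_wbtw ha hb hc hab hbc h, not_wbtw hb hc ha hbc hac.symm h,
    not_wbtw hc ha hb hac.symm hab h]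

theorem orient_pos_of_mem_vertexSet (hP : Convex ℝ P) (ha : a ∈ P) (hb : b ∈ P)
    (hc : c ∈ vertexSet P) (hd : d ∈ P) (habc : 0 < orient a b c) (hacd : 0 < orient a c d)
    (habd : 0 < orient a b d) : 0 < orient b c d := by
  by_contra! hbcd
  have hmem : c ∈ convexHull ℝ {a, b, d} := by
    refine mem_convexHull_of_orient_nonneg habd ?_ ?_ habc.le
    · linarith [orient_swap_right b c d]
    · exact (orient_rotate d a c).symm ▸ (orient_rotate a c d).symm ▸ hacd.le
  refine notMem_convexHull_of_mem_vertexSet hP hc ?_ ?_ hmem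
  · simp [Set.insert_subset_iff, ha, hb, hd]
  · rintro (rfl | rfl | rfl)
    · exact habc.ne' (orient_self_outer _ _)
    · exact habc.ne' (orient_self_right _ _)
    · exact hacd.ne' (orient_self_right _ _)

/-- The point `x` of the plane as an element of the lexicographic order, in which the vertices
succeeding a given one lie in a half-plane. -/
def planeLex (x : EuclideanSpace ℝ (Fin 2)) : ℝ ×ₗ ℝ := toLex (x 0, x 1)

theorem planeLex_injective : Function.Injective planeLex := fun x y h => by
  have h := Prod.ext_iff.1 (toLex_inj.1 h)
  ext i
  fin_cases i
  exacts [h.1, h.2]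

theorem apply_zero_lt_of_orient_pos (hab : planeLex a < planeLex b) (hac : a 0 ≤ c 0)
    (h : 0 < orient a b c) : a 0 < b 0 := by
  rcases Prod.Lex.toLex_lt_toLex.1 hab with h0 | ⟨h0, h1⟩
  · exact h0
  · dsimp only at h0 h1
    rw [orient, ← h0] at h
    nlinarith [mul_nonneg (sub_nonneg.2 h1.le) (sub_nonneg.2 hac)]

theorem orient_pos_trans (hab : planeLex a < planeLex b) (hac : planeLex a < planeLex c)
    (had : a 0 ≤ d 0) (hbc : 0 < orient a b c) (hcd : 0 < orient a c d) : 0 < orient a b d := by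
  have hc := sub_pos.2 (apply_zero_lt_of_orient_pos hac had hcd)
  have hb := sub_pos.2 (apply_zero_lt_of_orient_pos hab (sub_pos.1 hc).le hbc)
  have h : (c 0 - a 0) * orient a b d =
      (b 0 - a 0) * orient a c d + (d 0 - a 0) * orient a b c := by
    simp only [orient]; ring
  have := mul_pos hb hcd
  have := mul_nonneg (sub_nonneg.2 had) hbc.le
  exact pos_of_mul_pos_right (by linarith) hc.le

/-- The order in which a ray rotating counterclockwise around `a` meets points on one side of `a`,
the point `a` itself coming first. -/
def AngularLT (a b c : EuclideanSpace ℝ (Fin 2)) : Prop :=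
  (b = a ∧ c ≠ a) ∨ 0 < orient a b c

theorem isStrictTotalOrder_angularLT (ha : a ∈ vertexSet P)
    (hmin : ∀ b ∈ vertexSet P, planeLex a ≤ planeLex b) :
    IsStrictTotalOrder (vertexSet P) fun b c => AngularLT a b c where
  irrefl b h := h.elim (fun h => h.2 h.1) fun h => h.ne' (orient_self_right _ _)
  trans := by
    rintro ⟨b, hb⟩ ⟨c, hc⟩ ⟨d, hd⟩ (⟨rfl, hca⟩ | hbc) (⟨rfl, -⟩ | hcd)
    · exact absurd rfl hca
    · exact .inl ⟨rfl, fun hda => hcd.ne' (hda ▸ orient_self_outer _ _)⟩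
    · exact absurd (orient_self_outer _ _) hbc.ne'
    · have hlt {x y} (hx : x ∈ vertexSet P) (h : 0 < orient a x y) : planeLex a < planeLex x :=
        (hmin x hx).lt_of_ne fun hax => h.ne' (planeLex_injective hax ▸ orient_self_left _ _)
      exact .inr (orient_pos_trans (hlt hb hbc) (hlt hc hcd) (Prod.Lex.monotone_fst _ _ (hmin d hd))
        hbc hcd)
  trichotomous := by
    rintro ⟨b, hb⟩ ⟨c, hc⟩ hbc hcb
    simp only [AngularLT, not_or, not_and, not_not, not_lt] at hbc hcb
    by_contra hne
    have hne : b ≠ c := fun h => hne (Subtype.ext h)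
    have hba : a ≠ b := fun h => hne (h ▸ (hbc.1 h.symm).symm)
    have hca : a ≠ c := fun h => hne (h ▸ hcb.1 h.symm)
    exact orient_ne_zero_of_mem_vertexSet ha hb hc hba hca hne
      (hbc.2.antisymm (by linarith [orient_swap_right a b c]))

theorem AngularLT.ne (h : AngularLT a b c) : c ≠ a := by
  rcases h with h | h
  exacts [h.2, fun hca => h.ne' (hca ▸ orient_self_outer _ _)]

theorem orient_pos_of_angularLT (hP : Convex ℝ P) (ha : a ∈ P) (hb : b ∈ P)
    (hc : c ∈ vertexSet P) (hd : d ∈ P) (hbc : AngularLT a b c) (hcd : AngularLT a c d)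
    (hbd : AngularLT a b d) : 0 < orient b c d := by
  have hacd := hcd.resolve_left fun h => hbc.ne h.1
  rcases hbc with ⟨rfl, -⟩ | habc
  · exact hacd
  · have hab : b ≠ a := fun h => habc.ne' (h ▸ orient_self_left _ _)
    exact orient_pos_of_mem_vertexSet hP ha hb hc hd habc hacd
      (hbd.resolve_left fun h => hab h.1)

theorem exists_equiv_fin_of_isStrictTotalOrder {α : Type*} {n : ℕ} [Fintype α]
    (r : α → α → Prop) [IsStrictTotalOrder α r] (h : Fintype.card α = n) :
    ∃ e : Fin n ≃ α, ∀ i j, i < j → r (e i) (e j) := by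
  classical
  let := linearOrderOfSTO r
  exact ⟨(Fintype.orderIsoFinOfCardEq α h).toEquiv,
    fun _ _ hij => (Fintype.orderIsoFinOfCardEq α h).strictMono hij⟩

theorem IsPolytope.exists_isConvexPolygon {n : ℕ} [NeZero n] (hP : IsPolytope P)
    (hcard : (vertexSet P).encard = n) :
    ∃ p : Fin n → EuclideanSpace ℝ (Fin 2),
      IsConvexPolygon p ∧ P = convexHull ℝ (Set.range p) := by
  have hne : (vertexSet P).Nonempty := by
    rw [← Set.encard_ne_zero, hcard]
    exact_mod_cast NeZero.ne n
  obtain ⟨a, ha, hmin⟩ := Set.exists_min_image _ planeLex hP.finite_vertexSet hne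
  have := isStrictTotalOrder_angularLT ha hmin
  have := hP.finite_vertexSet.fintype
  obtain ⟨e, he⟩ := exists_equiv_fin_of_isStrictTotalOrder
    (fun b c : vertexSet P => AngularLT a b c) (n := n) (by
      rw [← Set.toFinset_card]
      exact_mod_cast (Set.encard_eq_coe_toFinset_card _).symm.trans hcard)
  refine ⟨fun i => e i, fun i j k hij hjk => ?_, ?_⟩
  · exact orient_pos_of_angularLT hP.convex ha.1 (e i).2.1 (e j).2 (e k).2.1 (he i j hij)
      (he j k hjk) (he i k (hij.trans hjk))
  · rw [Set.range_comp', e.range_eq_univ, Set.image_univ, Subtype.range_coe]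
    exact hP.eq_convexHull_vertexSet

end VertexOrder

section Pivots

variable {p : Fin 7 → EuclideanSpace ℝ (Fin 2)}

/-- The inequality making the cone at the vertices `p 1`, `p 2`, `p 4` of a heptagon contain the
superfluous sum of `IsConvexPolygon.dehomog_pivotVertex_one_add_four`. -/
def IsLeftPivot (p : Fin 7 → EuclideanSpace ℝ (Fin 2)) : Prop :=
  orient (p 0) (p 1) (p 2) * orient (p 4) (p 5) (p 6) ≤
    orient (p 5) (p 6) (p 0) * orient (p 1) (p 2) (p 4)

/-- The mirror image of `IsLeftPivot`. -/
def IsRightPivot (p : Fin 7 → EuclideanSpace ℝ (Fin 2)) : Prop :=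
  orient (p 5) (p 6) (p 0) * orient (p 1) (p 2) (p 3) ≤
    orient (p 0) (p 1) (p 2) * orient (p 3) (p 5) (p 6)

theorem isLeftPivot_mirror_neg : IsLeftPivot (fun i => mirror (p (-i))) ↔ IsRightPivot p := by
  simp only [IsLeftPivot, IsRightPivot, orient_mirror]
  change orient (p 0) (p 5) (p 6) * orient (p 3) (p 1) (p 2) ≤
    orient (p 2) (p 0) (p 1) * orient (p 6) (p 3) (p 5) ↔ _
  rw [orient_rotate (p 0) (p 5) (p 6), ← orient_rotate (p 3) (p 1) (p 2),
    ← orient_rotate (p 2) (p 0) (p 1), ← orient_rotate (p 6) (p 3) (p 5)]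

theorem prod_add_right (f : Fin 7 → ℝ) (a : Fin 7) : ∏ k, f (k + a) = ∏ k, f k :=
  Equiv.prod_comp (Equiv.addRight a) f

namespace IsConvexPolygon

theorem isRightPivot_or_isLeftPivot (hp : IsConvexPolygon p) :
    IsRightPivot p ∨ IsLeftPivot fun i => p (3 + i) := by
  by_contra! h
  obtain ⟨hR, hL⟩ := h
  rw [IsRightPivot, not_le] at hR
  simp only [IsLeftPivot, not_le, add_zero, Fin.isValue, Fin.reduceAdd] at hL
  have h012 : 0 < orient (p 0) (p 1) (p 2) := hp _ _ _ (by decide) (by decide)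
  have h123 : 0 < orient (p 1) (p 2) (p 3) := hp _ _ _ (by decide) (by decide)
  have h356 : 0 < orient (p 3) (p 5) (p 6) := hp _ _ _ (by decide) (by decide)
  have h450 : 0 < orient (p 4) (p 5) (p 0) := hp.orient_pos (Fin.sbtw_iff.2 (by decide))
  have h564 : 0 < orient (p 5) (p 6) (p 4) := hp.orient_pos (Fin.sbtw_iff.2 (by decide))
  have h503 : 0 < orient (p 5) (p 0) (p 3) := hp.orient_pos (Fin.sbtw_iff.2 (by decide))
  have hprod := mul_lt_mul'' hR hL (mul_pos h012 h356).le (mul_pos h123 h450).le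
  have hplucker := orient_mul_orient (p 5) (p 6) (p 0) (p 3) (p 4)
  rw [orient_rotate (p 3) (p 5) (p 6), orient_rotate (p 4) (p 5) (p 0),
    orient_rotate (p 4) (p 5) (p 3), orient_rotate (p 3) (p 4) (p 5)] at hplucker
  have hle : orient (p 5) (p 6) (p 0) * orient (p 3) (p 4) (p 5) ≤
      orient (p 3) (p 5) (p 6) * orient (p 4) (p 5) (p 0) :=
    hplucker ▸ le_add_of_nonneg_right (mul_pos h564 h503).le
  linarith [mul_le_mul_of_nonneg_left hle (mul_pos h012 h123).le]

theorem exists_isLeftPivot (hp : IsConvexPolygon p) : ∃ k, IsLeftPivot fun i => p (k + i) := by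
  by_contra! h
  let X : Fin 7 → ℝ := fun k => orient (p k) (p (k + 1)) (p (k + 2))
  let Y : Fin 7 → ℝ := fun k => orient (p k) (p (k + 1)) (p (k + 3))
  let Z : Fin 7 → ℝ := fun k => orient (p k) (p (k + 2)) (p (k + 4))
  have hX : ∀ k, 0 < X k := fun k => hp.orient_self_add_pos k (by decide) (by decide)
  have hY : ∀ k, 0 < Y k := fun k => hp.orient_self_add_pos k (by decide) (by decide)
  have hZ : ∀ k, 0 < Z k := fun k => hp.orient_self_add_pos k (by decide) (by decide)
  have hXY : ∏ k, X (k + 5) * Y (k + 1) < ∏ k, X k * X (k + 4) := by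
    refine Finset.prod_lt_prod_of_nonempty (fun k _ => mul_pos (hX _) (hY _)) (fun k _ => ?_)
      Finset.univ_nonempty
    simpa [IsLeftPivot, X, Y, add_assoc] using h k
  have hXZ : ∏ k, X k * Z (k + 3) ≤ ∏ k, Y k * Z (k + 5) := by
    refine Finset.prod_le_prod (fun k _ => (mul_pos (hX _) (hZ _)).le) (fun k _ => ?_)
    have h015 : 0 < orient (p k) (p (k + 1)) (p (k + 5)) :=
      hp.orient_self_add_pos k (by decide) (by decide)
    have h023 : 0 < orient (p k) (p (k + 2)) (p (k + 3)) :=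
      hp.orient_self_add_pos k (by decide) (by decide)
    have hplucker := orient_mul_orient (p k) (p (k + 1)) (p (k + 2)) (p (k + 3)) (p (k + 5))
    rw [orient_rotate (p (k + 5)) (p k) (p (k + 2)),
      ← orient_rotate (p k) (p (k + 3)) (p (k + 5))] at hplucker
    simpa [X, Y, Z, add_assoc] using
      (le_add_of_nonneg_right (mul_pos h015 h023).le).trans_eq hplucker.symm
  simp only [Finset.prod_mul_distrib, prod_add_right] at hXY hXZ
  have hYX := lt_of_mul_lt_mul_left hXY (Finset.prod_nonneg fun k _ => (hX k).le)
  exact hYX.not_ge (le_of_mul_le_mul_right hXZ (Finset.prod_pos fun k _ => hZ k))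

theorem exists_isRightPivot (hp : IsConvexPolygon p) : ∃ k, IsRightPivot fun i => p (k + i) := by
  obtain ⟨k, hk⟩ := hp.mirror_comp_neg.exists_isLeftPivot
  refine ⟨-k, isLeftPivot_mirror_neg.1 ?_⟩
  simpa only [neg_add] using hk

theorem exists_isLeftPivot_and_isRightPivot (hp : IsConvexPolygon p) :
    ∃ k, IsLeftPivot (fun i => p (k + i)) ∧ IsRightPivot fun i => p (k + i) := by
  by_contra! h
  obtain ⟨k, hk⟩ := hp.exists_isLeftPivot
  obtain ⟨j, hj⟩ := hp.exists_isRightPivot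
  have hnot (n : ℕ) : ¬ IsRightPivot fun i => p (k + n • 3 + i) := by
    induction n with
    | zero => simpa using h k hk
    | succ n ih =>
      refine h _ ?_
      have := ((hp.comp_add_left _).isRightPivot_or_isLeftPivot).resolve_left ih
      simpa only [succ_nsmul, add_assoc] using this
  -- `3` generates the cyclic group of the indices, with inverse `5`.
  have hj' : j = k + (5 * (j - k)).val • 3 := by
    clear * -
    revert j k
    decide
  exact hnot _ (hj' ▸ hj)

end IsConvexPolygon

end Pivots

section Heptagon

open scoped Pointwise

theorem encard_triple_le {α : Type*} (a b c : α) : ({a, b, c} : Set α).encard ≤ 3 := by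
  have h : ({b, c} : Set α).encard ≤ 1 + 1 :=
    Set.encard_singleton c ▸ Set.encard_insert_le {c} b
  exact (Set.encard_insert_le _ _).trans ((add_le_add_left h 1).trans_eq (by norm_num))

theorem add_eq_range_union {V : Type*} [AddCommGroup V] {w : Fin 7 → V}
    (h₂ : w 1 + w 3 - w 0 = w 2) (h₅ : w 4 + w 6 - w 0 = w 5) :
    ({w 4, w 0, w 3} + {w 6 - w 0, 0, w 1 - w 0} : Set V) =
      Set.range w ∪ {w 1 + w 4 - w 0, w 3 + w 6 - w 0} := by
  have h₁₄ : w 4 + (w 1 - w 0) = w 1 + w 4 - w 0 := by abel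
  have h₂' : w 3 + (w 1 - w 0) = w 2 := by rw [← h₂]; abel
  have h₅' : w 4 + (w 6 - w 0) = w 5 := by rw [← h₅]; abel
  have h₃₆ : w 3 + (w 6 - w 0) = w 3 + w 6 - w 0 := by abel
  simp only [Set.insert_eq, Set.union_add, Set.add_union, Set.singleton_add_singleton, add_zero,
    add_sub_cancel, h₁₄, h₂', h₅', h₃₆]
  ext v
  simp only [Set.mem_union, Set.mem_singleton_iff, Set.mem_range, eq_comm (b := v)]
  simp only [Fin.exists_fin_succ, Fin.exists_fin_zero, Fin.succ_zero_eq_one, Fin.reduceSucc]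
  tauto

/-- The weights with which the homogeneous coordinates of the vertices `p 0`, …, `p 3`, and likewise
those of `p 0`, `p 4`, `p 5`, `p 6`, form a parallelogram with `p 0` opposite to `p 2`, and to `p 5`
respectively. -/
noncomputable def pivotWeight (p : Fin 7 → EuclideanSpace ℝ (Fin 2)) : Fin 7 → ℝ :=
  ![1, orient (p 0) (p 2) (p 3) / orient (p 1) (p 2) (p 3),
    orient (p 0) (p 1) (p 3) / orient (p 1) (p 2) (p 3),
    orient (p 0) (p 1) (p 2) / orient (p 1) (p 2) (p 3),
    orient (p 0) (p 5) (p 6) / orient (p 4) (p 5) (p 6),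
    orient (p 0) (p 4) (p 6) / orient (p 4) (p 5) (p 6),
    orient (p 0) (p 4) (p 5) / orient (p 4) (p 5) (p 6)]

/-- The vertex `p i` in homogeneous coordinates of weight `pivotWeight p i`. -/
noncomputable def pivotVertex (p : Fin 7 → EuclideanSpace ℝ (Fin 2)) (i : Fin 7) :
    ℝ × EuclideanSpace ℝ (Fin 2) :=
  pivotWeight p i • homog (p i)

namespace IsConvexPolygon

variable {p : Fin 7 → EuclideanSpace ℝ (Fin 2)}

theorem pivotWeight_pos (hp : IsConvexPolygon p) (i : Fin 7) : 0 < pivotWeight p i := by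
  fin_cases i
  · exact one_pos
  all_goals exact div_pos (hp _ _ _ (by decide) (by decide)) (hp _ _ _ (by decide) (by decide))

theorem pivotVertex_one_add_three (hp : IsConvexPolygon p) :
    pivotVertex p 1 + pivotVertex p 3 - pivotVertex p 0 = pivotVertex p 2 := by
  have h : 0 < orient (p 1) (p 2) (p 3) := hp _ _ _ (by decide) (by decide)
  simpa only [pivotVertex, pivotWeight, Matrix.cons_val, one_smul] using homog_relation (p 0) h.ne'

theorem pivotVertex_four_add_six (hp : IsConvexPolygon p) :
    pivotVertex p 4 + pivotVertex p 6 - pivotVertex p 0 = pivotVertex p 5 := by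
  have h : 0 < orient (p 4) (p 5) (p 6) := hp _ _ _ (by decide) (by decide)
  simpa only [pivotVertex, pivotWeight, Matrix.cons_val, one_smul] using homog_relation (p 0) h.ne'

theorem dehomog_pivotVertex_one_add_four (hp : IsConvexPolygon p) (hL : IsLeftPivot p) :
    0 < (pivotVertex p 1 + pivotVertex p 4 - pivotVertex p 0).1 ∧
      dehomog (pivotVertex p 1 + pivotVertex p 4 - pivotVertex p 0) ∈
        convexHull ℝ {p 1, p 2, p 4} := by
  have h012 : 0 < orient (p 0) (p 1) (p 2) := hp _ _ _ (by decide) (by decide)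
  have h014 : 0 < orient (p 0) (p 1) (p 4) := hp _ _ _ (by decide) (by decide)
  have h123 : 0 < orient (p 1) (p 2) (p 3) := hp _ _ _ (by decide) (by decide)
  have h124 : 0 < orient (p 1) (p 2) (p 4) := hp _ _ _ (by decide) (by decide)
  have h234 : 0 < orient (p 2) (p 3) (p 4) := hp _ _ _ (by decide) (by decide)
  have h456 : 0 < orient (p 4) (p 5) (p 6) := hp _ _ _ (by decide) (by decide)
  have hl : orient (p 0) (p 2) (p 4) ≤ pivotWeight p 1 * orient (p 1) (p 2) (p 4) := by
    simp only [pivotWeight, Matrix.cons_val]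
    rw [div_mul_eq_mul_div, le_div_iff₀ h123]
    have hplucker := orient_mul_orient (p 2) (p 0) (p 1) (p 3) (p 4)
    rw [orient_swap_left (p 0) (p 2) (p 3), orient_swap_left (p 1) (p 2) (p 4),
      orient_swap_left (p 0) (p 2) (p 4), orient_swap_left (p 1) (p 2) (p 3), neg_mul_neg,
      neg_mul_neg, orient_rotate (p 1) (p 2) (p 0), orient_rotate (p 0) (p 1) (p 2)] at hplucker
    exact hplucker ▸ le_add_of_nonneg_left (mul_pos h012 h234).le
  have hm : orient (p 0) (p 1) (p 2) ≤ pivotWeight p 4 * orient (p 1) (p 2) (p 4) := by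
    simp only [pivotWeight, Matrix.cons_val]
    rw [div_mul_eq_mul_div, le_div_iff₀ h456, ← orient_rotate (p 0) (p 5) (p 6)]
    exact hL
  simpa only [pivotVertex, pivotWeight, Matrix.cons_val, one_smul] using
    dehomog_mem_convexHull h124 h014 hl hm

theorem dehomog_pivotVertex_three_add_six (hp : IsConvexPolygon p) (hR : IsRightPivot p) :
    0 < (pivotVertex p 3 + pivotVertex p 6 - pivotVertex p 0).1 ∧
      dehomog (pivotVertex p 3 + pivotVertex p 6 - pivotVertex p 0) ∈
        convexHull ℝ {p 3, p 5, p 6} := by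
  have h036 : 0 < orient (p 0) (p 3) (p 6) := hp _ _ _ (by decide) (by decide)
  have h056 : 0 < orient (p 0) (p 5) (p 6) := hp _ _ _ (by decide) (by decide)
  have h123 : 0 < orient (p 1) (p 2) (p 3) := hp _ _ _ (by decide) (by decide)
  have h345 : 0 < orient (p 3) (p 4) (p 5) := hp _ _ _ (by decide) (by decide)
  have h356 : 0 < orient (p 3) (p 5) (p 6) := hp _ _ _ (by decide) (by decide)
  have h456 : 0 < orient (p 4) (p 5) (p 6) := hp _ _ _ (by decide) (by decide)
  have hl : orient (p 0) (p 5) (p 6) ≤ pivotWeight p 3 * orient (p 3) (p 5) (p 6) := by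
    simp only [pivotWeight, Matrix.cons_val]
    rw [div_mul_eq_mul_div, le_div_iff₀ h123, ← orient_rotate (p 0) (p 5) (p 6)]
    exact hR
  have hm : orient (p 0) (p 3) (p 5) ≤ pivotWeight p 6 * orient (p 3) (p 5) (p 6) := by
    simp only [pivotWeight, Matrix.cons_val]
    rw [div_mul_eq_mul_div, le_div_iff₀ h456]
    have hplucker := orient_mul_orient (p 5) (p 6) (p 0) (p 3) (p 4)
    rw [orient_rotate (p 3) (p 5) (p 6), ← orient_rotate (p 5) (p 0) (p 4),
      orient_rotate (p 0) (p 5) (p 6), ← orient_rotate (p 5) (p 3) (p 4),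
      orient_rotate (p 4) (p 5) (p 6), ← orient_rotate (p 5) (p 0) (p 3)] at hplucker
    linarith [mul_pos h056 h345]
  simpa only [pivotVertex, pivotWeight, Matrix.cons_val, one_smul] using
    dehomog_mem_convexHull h356 h036 hl hm

theorem exists_isSectionOf (hp : IsConvexPolygon p) (hL : IsLeftPivot p) (hR : IsRightPivot p)
    {d : ℕ} (hd : 2 < d) :
    ∃ Q : Set (EuclideanSpace ℝ (Fin d)), IsPolytope Q ∧
      polyDim (convexHull ℝ (Set.range p)) < polyDim Q ∧ (vertexSet Q).encard ≤ 6 ∧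
      IsSectionOf (convexHull ℝ (Set.range p)) Q := by
  set w := pivotVertex p
  set L := w 1 + w 4 - w 0
  set R := w 3 + w 6 - w 0
  obtain ⟨hposL, hmemL⟩ := hp.dehomog_pivotVertex_one_add_four hL
  obtain ⟨hposR, hmemR⟩ := hp.dehomog_pivotVertex_three_add_six hR
  have hsum : ({w 4, w 0, w 3} + {w 6 - w 0, 0, w 1 - w 0} : Set _) = Set.range w ∪ {L, R} :=
    add_eq_range_union hp.pivotVertex_one_add_three hp.pivotVertex_four_add_six
  have himage : dehomog '' Set.range w = Set.range p := by
    rw [← Set.range_comp]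
    exact congrArg Set.range (funext fun i => dehomog_smul_homog (hp.pivotWeight_pos i).ne')
  have hpos : ∀ v ∈ Set.range w ∪ {L, R}, 0 < v.1 := by
    rintro _ (⟨i, rfl⟩ | rfl | rfl)
    · exact (hp.pivotWeight_pos i).trans_eq (mul_one _).symm
    · exact hposL
    · exact hposR
  have hhull : dehomog '' {L, R} ⊆ convexHull ℝ (Set.range p) := by
    rintro _ ⟨_, rfl | rfl, rfl⟩
    · exact convexHull_mono (by simp [Set.insert_subset_iff]) hmemL
    · exact convexHull_mono (by simp [Set.insert_subset_iff]) hmemR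
  have hP : convexHull ℝ (Set.range p) = convexHull ℝ (dehomog '' (Set.range w ∪ {L, R})) := by
    rw [Set.image_union, himage]
    exact (convexHull_mono Set.subset_union_left).antisymm
      (convexHull_min (Set.union_subset (subset_convexHull ℝ _) hhull) (convex_convexHull ℝ _))
  obtain ⟨Q, hQ, hdim, hcard, hsec⟩ := exists_isSectionOf_convexHull_dehomog_add hd
    (Set.toFinite _) (Set.toFinite _) (Set.insert_nonempty _ _) (Set.insert_nonempty _ _)
    (hsum ▸ hpos) (hsum ▸ hP)
  have hsix : (3 : ℕ∞) + 3 = 6 := by norm_num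
  exact ⟨Q, hQ, hdim, hcard.trans ((add_le_add (encard_triple_le ..) (encard_triple_le ..)).trans_eq
    hsix), hsec⟩

theorem exists_polyDim_eq_three_and_isSectionOf (hp : IsConvexPolygon p)
    (hdim : polyDim (convexHull ℝ (Set.range p)) = 2) :
    ∃ Q : Set (EuclideanSpace ℝ (Fin 3)), IsPolytope Q ∧ polyDim Q = 3 ∧
      (vertexSet Q).encard ≤ 6 ∧ IsSectionOf (convexHull ℝ (Set.range p)) Q := by
  obtain ⟨k, hL, hR⟩ := hp.exists_isLeftPivot_and_isRightPivot
  obtain ⟨Q, hQ, hlt, hcard, hsec⟩ :=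
    (hp.comp_add_left k).exists_isSectionOf hL hR (Nat.lt_succ_self 2)
  have hrange : (Set.range fun i => p (k + i)) = Set.range p :=
    (Equiv.addLeft k).surjective.range_comp p
  rw [hrange] at hlt hsec
  have hle : polyDim Q ≤ 3 := (Submodule.finrank_le _).trans_eq finrank_euclideanSpace_fin
  exact ⟨Q, hQ, by omega, hcard, hsec⟩

end IsConvexPolygon

end Heptagon

theorem theorem3 (P : Set (EuclideanSpace ℝ (Fin 2))) (hP : IsNGon 7 P) :
    intersectionComplexity P = 6 ∧
    extensionComplexity P = 6 ∧
    (∃ Q : Set (EuclideanSpace ℝ (Fin 3)),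
      IsPolytope Q ∧ polyDim Q = 3 ∧ (vertexSet Q).encard ≤ 6 ∧ IsSectionOf P Q) ∧
    (∀ (d : ℕ) (Q : Set (EuclideanSpace ℝ (Fin d))),
      IsPolytope Q → (vertexSet Q).encard ≤ 5 → ¬ IsSectionOf P Q) := by
  obtain ⟨p, hp, rfl⟩ := hP.1.exists_isConvexPolygon hP.2.2
  obtain ⟨Q, hQ, hdim, hcard, hsec⟩ := hp.exists_polyDim_eq_three_and_isSectionOf hP.2.1
  obtain ⟨m, W, hW, hfacets⟩ := hsec.exists_isExtensionOf hQ
  have hic : IsLeast {n : ℕ | ∃ (d : ℕ) (Q : Set (EuclideanSpace ℝ (Fin d))), IsPolytope Q ∧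
      IsSectionOf (convexHull ℝ (Set.range p)) Q ∧ (vertexSet Q).encard = n} 6 := by
    refine ⟨⟨3, Q, hQ, hsec, hcard.antisymm (hp.six_le_encard_vertexSet hQ hsec)⟩, ?_⟩
    rintro n ⟨d, Q', hQ', hsec', hn⟩
    exact_mod_cast hn ▸ hp.six_le_encard_vertexSet hQ' hsec'
  have hec : IsLeast {n : ℕ | ∃ (d : ℕ) (Q : Set (EuclideanSpace ℝ (Fin d))),
      IsExtensionOf Q (convexHull ℝ (Set.range p)) ∧ (facetSet Q).encard = n} 6 := by
    refine ⟨⟨m, W, hW, (hfacets.trans hcard).antisymm (hp.six_le_encard_facetSet hW)⟩, ?_⟩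
    rintro n ⟨d, Q', hQ', hn⟩
    exact_mod_cast hn ▸ hp.six_le_encard_facetSet hQ'
  refine ⟨hic.csInf_eq, hec.csInf_eq, ⟨Q, hQ, hdim, hcard, hsec⟩, fun d Q' hQ' hfive hsec' => ?_⟩
  have hsix := (hp.six_le_encard_vertexSet hQ' hsec').trans hfive
  norm_num at hsix
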